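/- For an integer $M\ge 1$, let $\mu_M$ be the critical three-colour mean-field Potts distribution on $\{1,2,3\}^M$, \[\mu_M(\sigma)\propto \exp\Big(M\tilde\beta_c\big(s_1(\sigma)^2+s_2(\sigma)^2+s_3(\sigma)^2\big)\Big),\qquad \tilde\beta_c:=2\log 2,\] where $s_k(\sigma)$ is the proportion of spins of colour $k$ in $\sigma$. Let $\sigma(0),\sigma(1),\ldots$ be the Glauber dynamics for $\mu_M$ (in each step a uniformly chosen spin is resampled from its conditional distribution under $\mu_M$ given the other spins), and let $S(t):=(s_1(\sigma(t)),s_2(\sigma(t)),s_3(\sigma(t)))$ be the magnetisation chain, whose state space $\Omega^S$ is the set of all possible vectors $(s_1(\sigma),s_2(\sigma),s_3(\sigma))$. For $s,s'\in\mathbb{R}^3$ put $d(s,s'):=\frac{1}{\sqrt 2}\big(\sum_{k=1}^3(s_k-s_k')^2\big)^{1/2}$, let \[C_1:=\left(\tfrac23,\tfrac16,\tfrac16\right),\quad C_2:=\left(\tfrac16,\tfrac23,\tfrac16\right),\quad C_3:=\left(\tfrac16,\tfrac16,\tfrac23\right),\quad C_4:=\left(\tfrac13,\tfrac13,\tfrac13\right),\]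 $d_C(s):=\min_{1\le i\le 4}d(s,C_i)$ and $\rho:=10^{-6}$, and let \[\tau:=\inf\{k\ge 0:\ d_C(S(k))\le \rho/2\}\in\{0,1,2,\ldots\}\cup\{\infty\}.\] \textbf{Proposition (Time to get to a central region).} There is an absolute constant $C>0$ such that for every $M$ for which at least one $z\in\Omega^S$ satisfies $d_C(z)\le\rho/2$ (in particular for every $M\ge 10^7$), every initial position $s\in\Omega^S$ and every real $r\ge 0$, \[\mathbb{P}\big(\tau> r\cdot C M\log(M)\,\big|\,S(0)=s\big)\le \exp(-\lfloor r\rfloor).\] -/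

import Mathlib

open MeasureTheory ProbabilityTheory

noncomputable section

namespace MeanFieldPotts

/-- Spin configurations of `M` spins with three colours; colours `1, 2, 3` are `0, 1, 2 : Fin 3`. -/
abbrev Config (M : ℕ) : Type := Fin M → Fin 3

/-- The magnetisation vector `(s₁(σ), s₂(σ), s₃(σ))`: the proportion of spins of each colour. -/
def magnetisation {M : ℕ} (σ : Config M) : Fin 3 → ℝ :=
  fun k => ((Finset.univ.filter fun l => σ l = k).card : ℝ) / M

/-- The state space `Ω^S` of the magnetisation chain. -/
def magStates (M : ℕ) : Set (Fin 3 → ℝ) := Set.range (magnetisation (M := M))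

/-- The critical inverse temperature of the three-colour mean-field model. -/
def betaCrit : ℝ := 2 * Real.log 2

/-- Unnormalised Gibbs weight of a configuration. -/
def gibbsWeight (M : ℕ) (β : ℝ) (σ : Config M) : ℝ :=
  Real.exp (M * β * ∑ k, magnetisation σ k ^ 2)

/-- The mean-field Potts (Gibbs) distribution on configurations, as a probability mass function. -/
def gibbs (M : ℕ) (β : ℝ) (σ : Config M) : ℝ :=
  gibbsWeight M β σ / ∑ σ', gibbsWeight M β σ'

/-- Under the Gibbs distribution, the conditional probability that spin `l` has colour `c`
given that all other spins are as in `σ`. -/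
def spinCondProb (M : ℕ) (β : ℝ) (σ : Config M) (l : Fin M) (c : Fin 3) : ℝ :=
  gibbs M β (Function.update σ l c) / ∑ c', gibbs M β (Function.update σ l c')

/-- Transition probabilities of the Glauber dynamics: a uniformly chosen spin is resampled
from its conditional distribution given the other spins. -/
def glauber (M : ℕ) (β : ℝ) (σ σ' : Config M) : ℝ :=
  ∑ l, (1 / (M : ℝ)) *
    ∑ c, if Function.update σ l c = σ' then spinCondProb M β σ l c else 0

/-- `X` is a time-homogeneous Markov chain on the countable discrete space `E` with transition
probabilities `P` and arbitrary initial law, on the probability space `(Ω, μ)`. -/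
structure IsMarkovChain {Ω E : Type*} [MeasurableSpace Ω] [MeasurableSpace E]
    (μ : Measure Ω) (P : E → E → ℝ) (X : ℕ → Ω → E) : Prop where
  measurable : ∀ n, Measurable (X n)
  markov : ∀ (n : ℕ) (x : ℕ → E),
    μ.real {ω | ∀ k ≤ n + 1, X k ω = x k} =
      μ.real {ω | ∀ k ≤ n, X k ω = x k} * P (x n) (x (n + 1))

/-- Distance on the main triangle: the Euclidean distance in barycentric coordinates with respect
to an equilateral triangle of side length one. -/
def triDist (s s' : Fin 3 → ℝ) : ℝ :=
  1 / √2 * √(∑ k, (s k - s' k) ^ 2)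

/-- The four centres `C₁, C₂, C₃, C₄`. -/
def centre : Fin 4 → Fin 3 → ℝ :=
  ![![2 / 3, 1 / 6, 1 / 6], ![1 / 6, 2 / 3, 1 / 6], ![1 / 6, 1 / 6, 2 / 3], ![1 / 3, 1 / 3, 1 / 3]]

/-- Distance to the closest of the four centres. -/
def centreDist (s : Fin 3 → ℝ) : ℝ :=
  min (min (triDist s (centre 0)) (triDist s (centre 1)))
    (min (triDist s (centre 2)) (triDist s (centre 3)))

/-- The constant `ρ = 10⁻⁶`. -/
def rho : ℝ := 1 / 10 ^ 6

/-- The first time that a trajectory `S` in the main triangle is within `ρ / 2` of one of the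
centres; it is `⊤` if this never happens. -/
def hitTime (S : ℕ → Fin 3 → ℝ) : ℕ∞ :=
  ⨅ (k : ℕ) (_ : centreDist (S k) ≤ rho / 2), (k : ℕ∞)

end MeanFieldPotts

end

/-! It suffices to find a function `V` on configurations with `0 ≤ V ≤ C M log M` whose mean
decreases by at least one per step outside the central region. Then the expected hitting time is at
most `C M log M` from every start, Markov's inequality bounds the probability of avoidance during `e
C M log M` steps by `1/e`, and restarting the chain gives `exp (-⌊r⌋)` (`avoidProb_le_exp`,
`tail_bound`).

With `δ = 1/M`, the magnetisation moves by increments of size `δ` with mean `δ • drift + O(δ²)`,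
where the drift is softmax minus identity and is proportional to the negative gradient of
`potential`. Hence the potential falls on average by a multiple of `δ |drift|²`, up to `O(δ²)`. At
this temperature the drift vanishes exactly at the four centres and at three saddles, the
permutations of `(1/2, 1/4, 1/4)` (`drift_eq_zero`). Outside the central region only the saddles
matter, and there `|drift|` is at least proportional to the distance from the nearest saddle
(`exists_driftSq_lower`).

Near a saddle the error `O(δ²)` may win. The cure is to add a multiple of a bump peaking at each
saddle: the noise has non-degenerate variance, so it lowers the bump on average by order `δ²`, while
the drift raises it little, since it pushes outward in the unstable direction and the other
directions carry a small weight `ε`. The sum `h` has mean increment at most `-c (δ |drift|² + δ²)`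
(`exists_lyapunov_profile`).

This decrease is weak near the saddles. As `|h - u₀| ≤ B |drift|²` with `u₀` the common value of `h`
at the saddles, the function `arsinh ((h - u₀) / (K δ))` magnifies `h` by about `1 / (|h - u₀| + K
δ)`, just enough to make the decrease at least a constant times `δ` everywhere; its range is only
`O(log (1/δ))`. Dividing by that multiple of `δ` gives `V` of size `M log M` (`exists_unit_drift`).

This works for all large `M`. The finitely many remaining `M` use a crude function of the Hamming
distance to one central configuration (`exists_hasLyapunov_fixed`). -/

noncomputable section

namespace MeanFieldPotts

/-! ### Finite Markov chains: avoidance probabilities and Lyapunov functions. -/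

section MarkovChain

variable {Ω E : Type*}

/-- Probability that a finite chain with kernel `P` avoids `A` up to time `n`, as a function
of the starting point. -/
def avoidProb (P : E → E → ℝ) [Fintype E] (A : Set E) [DecidablePred (· ∈ A)] : ℕ → E → ℝ
  | 0, x => if x ∈ A then 0 else 1
  | n + 1, x => if x ∈ A then 0 else ∑ y, P x y * avoidProb P A n y

/-- The elementary Markov property with the first `j` coordinates restricted to sets. -/
theorem IsMarkovChain.markov_of_sets [MeasurableSpace Ω] [MeasurableSpace E] [Fintype E] [MeasurableSingletonClass E]
    {μ : Measure Ω} [IsProbabilityMeasure μ] {P : E → E → ℝ} {X : ℕ → Ω → E}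
    (hX : IsMarkovChain μ P X) (G : ℕ → Set E) (n j : ℕ) (hj : j ≤ n) (x : ℕ → E) :
    μ.real {ω | (∀ k < j, X k ω ∈ G k) ∧ ∀ k, j ≤ k → k ≤ n + 1 → X k ω = x k} =
      μ.real {ω | (∀ k < j, X k ω ∈ G k) ∧ ∀ k, j ≤ k → k ≤ n → X k ω = x k} *
        P (x n) (x (n + 1)) := by
  classical
  induction j generalizing x with
  | zero => simpa using hX.markov n x
  | succ j ih =>
    have meas : ∀ (m : ℕ) (y : ℕ → E), MeasurableSet
        {ω | (∀ k < j, X k ω ∈ G k) ∧ ∀ k, j ≤ k → k ≤ m → X k ω = y k} := by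
      intro m y
      rw [Set.ofPred_and]
      refine MeasurableSet.inter ?_ ?_
      · simp only [Set.ofPred_forall]
        exact MeasurableSet.iInter fun k => MeasurableSet.iInter fun _ =>
          hX.measurable k (Set.toFinite _).measurableSet
      · simp only [Set.ofPred_forall]
        exact MeasurableSet.iInter fun k => MeasurableSet.iInter fun _ => MeasurableSet.iInter
          fun _ => hX.measurable k (measurableSet_singleton _)
    -- Splitting over the value `z ∈ G j` of the chain at time `j` turns the set constraint into a
    -- pinned one; the pinned path is `x` with its entry at `j` replaced by `z`.
    have key : ∀ m, j ≤ m →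
        μ.real {ω | (∀ k < j + 1, X k ω ∈ G k) ∧ ∀ k, j + 1 ≤ k → k ≤ m → X k ω = x k} =
          ∑ z ∈ Finset.univ.filter (· ∈ G j), μ.real {ω | (∀ k < j, X k ω ∈ G k) ∧
            ∀ k, j ≤ k → k ≤ m → X k ω = Function.update x j z k} := by
      intro m hm
      rw [← measureReal_biUnion_finset]
      · congr 1
        ext ω
        simp only [Set.mem_ofPred_eq, Set.mem_iUnion, Finset.mem_filter, Finset.mem_univ,
          true_and, exists_prop]
        constructor
        · rintro ⟨h1, h2⟩
          refine ⟨X j ω, h1 j (by omega), fun k hk => h1 k (by omega), fun k hk hk' => ?_⟩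
          rcases eq_or_ne k j with rfl | hne
          · simp
          · rw [Function.update_of_ne hne]; exact h2 k (by omega) hk'
        · rintro ⟨z, hz, h1, h2⟩
          refine ⟨fun k hk => ?_, fun k hk hk' => ?_⟩
          · rcases eq_or_ne k j with rfl | hne
            · rw [h2 k le_rfl hm]; simpa using hz
            · exact h1 k (by omega)
          · rw [h2 k (by omega) hk', Function.update_of_ne (by omega)]
      · intro z _ z' _ hzz
        rw [Function.onFun, Set.disjoint_left]
        rintro ω ⟨-, h⟩ ⟨-, h'⟩
        have e1 := h j le_rfl hm
        have e2 := h' j le_rfl hm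
        simp only [Function.update_self] at e1 e2
        exact hzz (e1.symm.trans e2)
      · intro z _; exact meas _ _
    rw [key (n + 1) (by omega), key n (by omega), Finset.sum_mul]
    refine Finset.sum_congr rfl fun z _ => ?_
    rw [ih (by omega), Function.update_of_ne (by omega), Function.update_of_ne (by omega)]

/-- Duality between the forward evolution of the surviving mass `m` and the backward recursion
`avoidProb`: one step can be moved from one factor to the other. A set `I` of starting points is
needed because many configurations share one magnetisation. -/
theorem IsMarkovChain.measureReal_avoid [MeasurableSpace Ω] [MeasurableSpace E] [Fintype E] [MeasurableSingletonClass E]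
    {μ : Measure Ω} [IsProbabilityMeasure μ] {P : E → E → ℝ} {X : ℕ → Ω → E}
    (hX : IsMarkovChain μ P X) (A I : Set E) [DecidablePred (· ∈ A)] [DecidablePred (· ∈ I)]
    (n : ℕ) :
    μ.real {ω | X 0 ω ∈ I ∧ ∀ k ≤ n, X k ω ∉ A} =
      ∑ x ∈ Finset.univ.filter (· ∈ I), μ.real {ω | X 0 ω = x} * avoidProb P A n x := by
  classical
  -- The initial condition is encoded as an extra constraint at time `0`.
  let G : ℕ → Set E := fun k => {x | (k = 0 → x ∈ I) ∧ x ∉ A}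
  let m : ℕ → E → ℝ := fun j x => μ.real {ω | (∀ k < j + 1, X k ω ∈ G k) ∧ X j ω = x}
  have measG : ∀ j, MeasurableSet {ω | ∀ k < j, X k ω ∈ G k} := by
    intro j
    simp only [Set.ofPred_forall]
    exact MeasurableSet.iInter fun k => MeasurableSet.iInter fun _ =>
      hX.measurable k (Set.toFinite _).measurableSet
  have measE : ∀ j x, MeasurableSet {ω | X j ω = x} := fun j x =>
    hX.measurable j (measurableSet_singleton x)
  have split : ∀ (S : Set Ω) (j : ℕ), MeasurableSet S →
      μ.real S = ∑ x, μ.real (S ∩ {ω | X j ω = x}) := by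
    intro S j hS
    rw [← measureReal_biUnion_finset]
    · congr 1; ext ω; simp
    · intro z _ z' _ hzz
      rw [Function.onFun, Set.disjoint_left]
      rintro ω ⟨-, h⟩ ⟨-, h'⟩
      exact hzz (h.symm.trans h')
    · intro x _; exact hS.inter (measE j x)
  have mA : ∀ j x, x ∈ A → m j x = 0 := by
    intro j x hx
    have : {ω | (∀ k < j + 1, X k ω ∈ G k) ∧ X j ω = x} = ∅ := by
      ext ω
      simp only [Set.mem_ofPred_eq, Set.mem_empty_iff_false, iff_false, not_and]
      intro h e
      exact (h j (by omega)).2 (e ▸ hx)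
    simp only [m, this, measureReal_empty]
  have mstep : ∀ j y, y ∉ A → m (j + 1) y = ∑ x, m j x * P x y := by
    intro j y hy
    simp only [m]
    rw [split {ω | (∀ k < j + 1 + 1, X k ω ∈ G k) ∧ X (j + 1) ω = y} j
      ((measG _).inter (measE _ _))]
    refine Finset.sum_congr rfl fun x _ => ?_
    by_cases hx : x ∈ G j
    · have h := hX.markov_of_sets G j j le_rfl (fun k => if k = j then x else y)
      simp only [if_true] at h
      rw [if_neg (by omega)] at h
      convert h using 2
      · ext ω
        simp only [Set.mem_inter_iff, Set.mem_ofPred_eq]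
        constructor
        · rintro ⟨⟨h1, h2⟩, h3⟩
          refine ⟨fun k hk => h1 k (by omega), fun k hk hk' => ?_⟩
          rcases (by omega : k = j ∨ k = j + 1) with rfl | rfl
          · simpa using h3
          · simpa using h2
        · rintro ⟨h1, h2⟩
          have e1 := h2 j le_rfl (by omega)
          have e2 := h2 (j + 1) (by omega) le_rfl
          simp only [if_true] at e1
          rw [if_neg (by omega)] at e2
          refine ⟨⟨fun k hk => ?_, e2⟩, e1⟩
          rcases (by omega : k < j ∨ k = j ∨ k = j + 1) with h | rfl | rfl
          · exact h1 k h
          · rw [e1]; exact hx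
          · rw [e2]; exact ⟨fun h => by omega, hy⟩
      · congr 1
        ext ω
        simp only [Set.mem_ofPred_eq]
        constructor
        · rintro ⟨h1, h2⟩
          refine ⟨fun k hk => h1 k (by omega), fun k hk hk' => ?_⟩
          obtain rfl : k = j := by omega
          simpa using h2
        · rintro ⟨h1, h2⟩
          have e1 := h2 j le_rfl le_rfl
          simp only [if_true] at e1
          refine ⟨fun k hk => ?_, e1⟩
          rcases (by omega : k < j ∨ k = j) with h | rfl
          · exact h1 k h
          · rw [e1]; exact hx
    · have e1 : {ω | (∀ k < j + 1 + 1, X k ω ∈ G k) ∧ X (j + 1) ω = y} ∩ {ω | X j ω = x} = ∅ := by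
        ext ω
        simp only [Set.mem_inter_iff, Set.mem_ofPred_eq, Set.mem_empty_iff_false, iff_false]
        rintro ⟨⟨h, -⟩, e⟩
        exact hx (e ▸ h j (by omega))
      have e2 : {ω | (∀ k < j + 1, X k ω ∈ G k) ∧ X j ω = x} = ∅ := by
        ext ω
        simp only [Set.mem_ofPred_eq, Set.mem_empty_iff_false, iff_false]
        rintro ⟨h, e⟩
        exact hx (e ▸ h j (by omega))
      rw [e1, e2]; simp
  -- One step of time passes from the forward mass to the backward avoidance probability; iterating
  -- brings everything to time `0`.
  have trans : ∀ j i, ∑ x, m (j + 1) x * avoidProb P A i x = ∑ x, m j x * avoidProb P A (i + 1) x := by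
    intro j i
    have h1 : ∀ y, m (j + 1) y * avoidProb P A i y =
        ∑ x, m j x * P x y * avoidProb P A i y := by
      intro y
      by_cases hy : y ∈ A
      · have : avoidProb P A i y = 0 := by cases i <;> simp [avoidProb, hy]
        simp [this]
      · rw [mstep j y hy, Finset.sum_mul]
    simp_rw [h1]
    rw [Finset.sum_comm]
    refine Finset.sum_congr rfl fun x _ => ?_
    by_cases hx : x ∈ A
    · simp [mA j x hx]
    · simp only [avoidProb, hx, if_false, Finset.mul_sum, mul_assoc]
  have all : ∀ j i, ∑ x, m j x * avoidProb P A i x = ∑ x, m 0 x * avoidProb P A (i + j) x := by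
    intro j
    induction j with
    | zero => intro i; rfl
    | succ j ih => intro i; rw [trans, ih]; congr! 3; omega
  have first : μ.real {ω | X 0 ω ∈ I ∧ ∀ k ≤ n, X k ω ∉ A} =
      ∑ x, m n x * avoidProb P A 0 x := by
    have e : {ω | X 0 ω ∈ I ∧ ∀ k ≤ n, X k ω ∉ A} = {ω | ∀ k < n + 1, X k ω ∈ G k} := by
      ext ω
      simp only [Set.mem_ofPred_eq, G]
      constructor
      · rintro ⟨h1, h2⟩ k hk
        exact ⟨by rintro rfl; exact h1, h2 k (by omega)⟩
      · intro h
        exact ⟨(h 0 (by omega)).1 rfl, fun k hk => (h k (by omega)).2⟩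
    rw [e, split _ n (measG _)]
    refine Finset.sum_congr rfl fun x _ => ?_
    by_cases hx : x ∈ A
    · have := mA n x hx
      simp only [avoidProb, hx, if_true, mul_zero]
      exact this
    · simp only [avoidProb, hx, if_false, mul_one]
      rfl
  rw [first, all, zero_add, Finset.sum_filter]
  refine Finset.sum_congr rfl fun x _ => ?_
  by_cases hx : x ∈ A
  · have : avoidProb P A n x = 0 := by cases n <;> simp [avoidProb, hx]
    simp [this]
  · simp only [m, G]
    by_cases hI : x ∈ I
    · simp only [hI, if_true]
      congr 2
      ext ω
      simp only [Set.mem_ofPred_eq]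
      constructor
      · exact fun h => h.2
      · intro h
        refine ⟨fun k hk => ?_, h⟩
        obtain rfl : k = 0 := by omega
        rw [h]; exact ⟨fun _ => hI, hx⟩
    · simp only [hI, if_false]
      have : {ω | (∀ k < 0 + 1, X k ω ∈ {x | (k = 0 → x ∈ I) ∧ x ∉ A}) ∧ X 0 ω = x} = ∅ := by
        ext ω
        simp only [Set.mem_ofPred_eq, Set.mem_empty_iff_false, iff_false]
        rintro ⟨h, e⟩
        exact hI (e ▸ (h 0 (by omega)).1 rfl)
      rw [this]; simp

section Bounds

variable [Fintype E] {P : E → E → ℝ} {A : Set E} [DecidablePred (· ∈ A)]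

/-- Restarting at time `n`: wherever the chain is then, it survives `m` further steps with
probability at most `q`. -/
theorem avoidProb_add_le (hP : ∀ x y, 0 ≤ P x y) {m : ℕ} {q : ℝ}
    (hq : ∀ x, avoidProb P A m x ≤ q)
    (n : ℕ) (x : E) : avoidProb P A (n + m) x ≤ q * avoidProb P A n x := by
  induction n generalizing x with
  | zero =>
    rw [zero_add]
    by_cases hx : x ∈ A
    · cases m <;> simp [avoidProb, hx]
    · simpa [avoidProb, hx] using hq x
  | succ n ih =>
    rw [show n + 1 + m = n + m + 1 by omega]
    simp only [avoidProb]
    split_ifs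
    · simp
    · rw [Finset.mul_sum]
      refine Finset.sum_le_sum fun y _ => ?_
      calc P x y * avoidProb P A (n + m) y ≤ P x y * (q * avoidProb P A n y) :=
            mul_le_mul_of_nonneg_left (ih y) (hP x y)
        _ = _ := by ring

theorem avoidProb_le_one (hP : ∀ x y, 0 ≤ P x y) (hP1 : ∀ x, ∑ y, P x y = 1) (n : ℕ) (x : E) :
    avoidProb P A n x ≤ 1 := by
  induction n generalizing x with
  | zero => simp only [avoidProb]; split_ifs <;> norm_num
  | succ n ih =>
    simp only [avoidProb]
    split_ifs
    · exact zero_le_one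
    · calc ∑ y, P x y * avoidProb P A n y ≤ ∑ y, P x y * 1 :=
            Finset.sum_le_sum fun y _ => mul_le_mul_of_nonneg_left (ih y) (hP x y)
        _ = 1 := by simp [hP1]

theorem avoidProb_succ_le (hP : ∀ x y, 0 ≤ P x y) (hP1 : ∀ x, ∑ y, P x y = 1) (n : ℕ) (x : E) :
    avoidProb P A (n + 1) x ≤ avoidProb P A n x := by
  have h := avoidProb_add_le (A := A) hP (m := 1)
    (avoidProb_le_one hP hP1 1) n x
  simpa using h

/-- Expected hitting times are bounded by a Lyapunov function with unit drift. -/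
theorem mul_avoidProb_le (hP : ∀ x y, 0 ≤ P x y) (hP1 : ∀ x, ∑ y, P x y = 1) {V : E → ℝ}
    (hV0 : ∀ x, 0 ≤ V x) (hV : ∀ x, x ∉ A → ∑ y, P x y * V y ≤ V x - 1) (n : ℕ) (x : E) :
    (n + 1) * avoidProb P A n x ≤ V x := by
  -- The sum is a truncated expected hitting time. First-step analysis works because the term `i =
  -- 0` contributes one, which the unit drift pays for.
  have h1 : ∀ n x, ∑ i ∈ Finset.range n, avoidProb P A i x ≤ V x := by
    intro n
    induction n with
    | zero => intro x; simpa using hV0 x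
    | succ n ih =>
      intro x
      rw [Finset.sum_range_succ']
      by_cases hx : x ∈ A
      · simpa [avoidProb, hx] using hV0 x
      · simp only [avoidProb, hx, if_false]
        rw [Finset.sum_comm]
        have : ∑ y, ∑ i ∈ Finset.range n, P x y * avoidProb P A i y ≤ ∑ y, P x y * V y := by
          refine Finset.sum_le_sum fun y _ => ?_
          rw [← Finset.mul_sum]
          exact mul_le_mul_of_nonneg_left (ih y) (hP x y)
        linarith [hV x hx]
  have hanti : Antitone fun i => avoidProb P A i x :=
    antitone_nat_of_succ_le fun i => avoidProb_succ_le hP hP1 i x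
  calc ((n : ℝ) + 1) * avoidProb P A n x = ∑ i ∈ Finset.range (n + 1), avoidProb P A n x := by
        simp
    _ ≤ ∑ i ∈ Finset.range (n + 1), avoidProb P A i x :=
        Finset.sum_le_sum fun i hi => hanti (by have := Finset.mem_range.1 hi; omega)
    _ ≤ V x := h1 _ _

/-- Markov's inequality over a window of length `e B` costs a factor `1/e` uniformly in the start,
and windows multiply by the restart bound. -/
theorem avoidProb_le_exp (hP : ∀ x y, 0 ≤ P x y) (hP1 : ∀ x, ∑ y, P x y = 1) {V : E → ℝ}
    (hV0 : ∀ x, 0 ≤ V x) (hV : ∀ x, x ∉ A → ∑ y, P x y * V y ≤ V x - 1) {B : ℝ}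
    (hB : ∀ x, V x ≤ B) {T : ℕ} (hT : Real.exp 1 * B ≤ T) (k : ℕ) (x : E) :
    avoidProb P A (k * T) x ≤ Real.exp (-k) := by
  have h1 : ∀ x, avoidProb P A T x ≤ Real.exp (-1) := by
    intro x
    have h := mul_avoidProb_le hP hP1 hV0 hV T x
    have hT1 : (0 : ℝ) < T + 1 := by positivity
    rw [← le_div_iff₀' hT1] at h
    refine h.trans ?_
    rw [div_le_iff₀ hT1, Real.exp_neg, ← div_eq_inv_mul, le_div_iff₀ (Real.exp_pos 1)]
    nlinarith [hB x, Real.exp_pos 1]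
  induction k with
  | zero => simpa using avoidProb_le_one hP hP1 0 x
  | succ k ih =>
    have h := avoidProb_add_le hP h1 (k * T) x
    rw [show (k + 1) * T = k * T + T by ring]
    refine h.trans ?_
    calc _ ≤ Real.exp (-1) * Real.exp (-k) := mul_le_mul_of_nonneg_left ih (Real.exp_pos _).le
      _ = _ := by rw [← Real.exp_add]; congr 1; push_cast; ring

end Bounds

end MarkovChain

/-! ### Softmax form of the Glauber updates. -/

/-- The slope `2 β̃_c = 4 log 2` of the exponential weights in the Glauber updates. -/
def slope : ℝ := 4 * Real.log 2

theorem slope_pos : 0 < slope := by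
  have := Real.log_pos (by norm_num : (1 : ℝ) < 2)
  unfold slope; linarith

/-- The limiting colour distribution of a resampled spin. -/
def softmax (s : Fin 3 → ℝ) (k : Fin 3) : ℝ :=
  Real.exp (slope * s k) / ∑ j, Real.exp (slope * s j)

theorem sum_exp_pos (s : Fin 3 → ℝ) : 0 < ∑ j, Real.exp (slope * s j) :=
  Finset.sum_pos (fun _ _ => Real.exp_pos _) Finset.univ_nonempty

theorem softmax_pos (s : Fin 3 → ℝ) (k : Fin 3) : 0 < softmax s k :=
  div_pos (Real.exp_pos _) (sum_exp_pos s)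

theorem sum_softmax (s : Fin 3 → ℝ) : ∑ k, softmax s k = 1 := by
  simp only [softmax]
  rw [← Finset.sum_div, div_self (sum_exp_pos s).ne']

section Glauber

variable {M : ℕ}

theorem magnetisation_update (σ : Config M) (l : Fin M) (c : Fin 3) :
    magnetisation (Function.update σ l c) =
      magnetisation σ - Pi.single (σ l) (1 / (M : ℝ)) + Pi.single c (1 / (M : ℝ)) := by
  have hsum : ∀ (τ : Config M) (k : Fin 3), magnetisation τ k =
      (∑ i, if τ i = k then (1 : ℝ) else 0) / M := by
    intro τ k
    simp [magnetisation]
  ext k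
  simp only [Pi.add_apply, Pi.sub_apply, hsum]
  rw [← Finset.add_sum_erase _ _ (Finset.mem_univ l),
    ← Finset.add_sum_erase _ (fun i => if σ i = k then (1 : ℝ) else 0) (Finset.mem_univ l)]
  have : ∑ i ∈ Finset.univ.erase l, (if Function.update σ l c i = k then (1 : ℝ) else 0) =
      ∑ i ∈ Finset.univ.erase l, if σ i = k then (1 : ℝ) else 0 :=
    Finset.sum_congr rfl fun i hi => by rw [Function.update_of_ne (Finset.ne_of_mem_erase hi)]
  rw [this]
  simp only [Function.update_self, Pi.single_apply, @eq_comm _ k]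
  split_ifs <;> ring

/-- With the chosen spin removed, adding colour `c` changes the sum of squares by `2 t c / M + 1 /
M²`; the last term is independent of `c` and cancels on normalising, and `M β̃_c` times the first is
`slope * t c`. -/
theorem spinCondProb_eq (hM : M ≠ 0) (σ : Config M) (l : Fin M) (c : Fin 3) :
    spinCondProb M betaCrit σ l c =
      softmax (magnetisation σ - Pi.single (σ l) (1 / (M : ℝ))) c := by
  set t := magnetisation σ - Pi.single (σ l) (1 / (M : ℝ)) with ht
  have hM' : (M : ℝ) ≠ 0 := by exact_mod_cast hM
  have hw : ∀ c, gibbsWeight M betaCrit (Function.update σ l c) =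
      Real.exp (M * betaCrit * (∑ k, t k ^ 2 + 1 / (M : ℝ) ^ 2)) * Real.exp (slope * t c) := by
    intro c
    rw [gibbsWeight, magnetisation_update, ← ht, ← Real.exp_add]
    congr 1
    have : ∑ k, (t + Pi.single c (1 / (M : ℝ)) : Fin 3 → ℝ) k ^ 2 =
        ∑ k, t k ^ 2 + 2 * t c / M + 1 / (M : ℝ) ^ 2 := by
      have e : ∀ k, (t + Pi.single c (1 / (M : ℝ)) : Fin 3 → ℝ) k ^ 2 =
          t k ^ 2 + if k = c then 2 * t c / M + 1 / (M : ℝ) ^ 2 else 0 := by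
        intro k
        by_cases hk : k = c
        · subst hk; simp; ring
        · simp [hk]
      simp_rw [e, Finset.sum_add_distrib]
      simp; ring
    rw [this]
    unfold slope betaCrit
    field_simp
    ring
  have hZ : (∑ τ : Config M, gibbsWeight M betaCrit τ) ≠ 0 := by
    have : Nonempty (Config M) := ⟨σ⟩
    exact (Finset.sum_pos (fun _ _ => Real.exp_pos _) Finset.univ_nonempty).ne'
  simp only [spinCondProb, gibbs]
  rw [← Finset.sum_div, div_div_div_cancel_right₀ hZ]
  simp_rw [hw]
  rw [← Finset.mul_sum, mul_div_mul_left _ _ (Real.exp_pos _).ne', softmax]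

theorem sum_glauber_mul (σ : Config M) (h : Config M → ℝ) :
    ∑ σ', glauber M betaCrit σ σ' * h σ' =
      ∑ l, 1 / (M : ℝ) * ∑ c, spinCondProb M betaCrit σ l c * h (Function.update σ l c) := by
  simp only [glauber, Finset.sum_mul]
  rw [Finset.sum_comm]
  refine Finset.sum_congr rfl fun l _ => ?_
  simp only [mul_assoc]
  rw [← Finset.mul_sum]
  congr 1
  simp only [Finset.sum_mul]
  rw [Finset.sum_comm]
  refine Finset.sum_congr rfl fun c _ => ?_
  simp

theorem glauber_nonneg (hM : M ≠ 0) (σ σ' : Config M) : 0 ≤ glauber M betaCrit σ σ' := by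
  refine Finset.sum_nonneg fun l _ => mul_nonneg (by positivity) (Finset.sum_nonneg fun c _ => ?_)
  split_ifs
  · rw [spinCondProb_eq hM]; exact (softmax_pos _ _).le
  · exact le_rfl

theorem sum_glauber (hM : M ≠ 0) (σ : Config M) : ∑ σ', glauber M betaCrit σ σ' = 1 := by
  have h := sum_glauber_mul σ fun _ => 1
  simp only [mul_one] at h
  rw [h]
  simp_rw [spinCondProb_eq hM, sum_softmax]
  have hM' : (M : ℝ) ≠ 0 := by exact_mod_cast hM
  simp [hM']

end Glauber

/-! ### Reduction to a Lyapunov function of order `M log M`. -/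

/-- Configurations in the central region. -/
def central (M : ℕ) : Set (Config M) := {σ | centreDist (magnetisation σ) ≤ rho / 2}

/-- A Lyapunov function with unit drift outside the central region, bounded by `C M log M`. -/
def HasLyapunov (M : ℕ) (C : ℝ) : Prop :=
  ∃ V : Config M → ℝ, (∀ σ, 0 ≤ V σ) ∧ (∀ σ, V σ ≤ C * (M * Real.log M)) ∧
    ∀ σ, σ ∉ central M → ∑ σ', glauber M betaCrit σ σ' * V σ' ≤ V σ - 1

theorem HasLyapunov.mono {M : ℕ} (hM : 3 ≤ M) {C C' : ℝ} (hC : C ≤ C') (h : HasLyapunov M C) :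
    HasLyapunov M C' := by
  obtain ⟨V, h0, h1, h2⟩ := h
  refine ⟨V, h0, fun σ => (h1 σ).trans (mul_le_mul_of_nonneg_right hC ?_), h2⟩
  have : 0 ≤ Real.log M := Real.log_nonneg (by exact_mod_cast (by omega : 1 ≤ M))
  positivity

theorem one_le_log_of_three_le {M : ℕ} (hM : 3 ≤ M) : 1 ≤ Real.log M := by
  rw [Real.le_log_iff_exp_le (by positivity)]
  have : (3 : ℝ) ≤ M := by exact_mod_cast hM
  linarith [Real.exp_one_lt_d9]

theorem tail_bound {M : ℕ} (hM : 3 ≤ M) {C : ℝ} (hC : 0 ≤ C) (hV : HasLyapunov M C)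
    {Ω : Type*} [MeasurableSpace Ω] (μ : Measure Ω) [IsProbabilityMeasure μ]
    (σ : ℕ → Ω → Config M) (hσ : IsMarkovChain μ (glauber M betaCrit) σ)
    (S : ℕ → Ω → Fin 3 → ℝ) (hS : ∀ k ω, S k ω = magnetisation (σ k ω))
    (s : Fin 3 → ℝ) (hs : μ {ω | S 0 ω = s} ≠ 0) (r : ℝ) (hr : 0 ≤ r) :
    (μ[|{ω | S 0 ω = s}]).real
        {ω | ((r * ((Real.exp 1 * C + 1) * M * Real.log M) : ℝ) : EReal) <
          ((hitTime fun k => S k ω : ℕ∞) : EReal)} ≤ Real.exp (-(⌊r⌋ : ℝ)) := by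
  classical
  obtain ⟨V, h0, h1, h2⟩ := hV
  have hM0 : M ≠ 0 := by omega
  have hML : 1 ≤ M * Real.log M := by
    have h3 : (3 : ℝ) ≤ M := by exact_mod_cast hM
    nlinarith [one_le_log_of_three_le hM]
  set T := ⌈Real.exp 1 * (C * (M * Real.log M))⌉₊ with hT
  have hTlow : Real.exp 1 * (C * (M * Real.log M)) ≤ T := Nat.le_ceil _
  -- The extra `+ 1` in the constant absorbs the ceiling, since `M log M ≥ 1`.
  have hTup : (T : ℝ) ≤ (Real.exp 1 * C + 1) * M * Real.log M := by
    have := (Nat.ceil_lt_add_one (a := Real.exp 1 * (C * (M * Real.log M))) (by positivity)).le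
    rw [← hT] at this
    linarith
  set n := ⌊r⌋₊ * T with hn
  have hnr : (n : ℝ) ≤ r * ((Real.exp 1 * C + 1) * M * Real.log M) := by
    rw [hn]; push_cast
    exact mul_le_mul (Nat.floor_le hr) hTup (by positivity) hr
  set I : Set (Config M) := {x | magnetisation x = s}
  have hI : {ω | S 0 ω = s} = {ω | σ 0 ω ∈ I} := by
    ext ω; simp [hS, I]
  have hImeas : MeasurableSet {ω | σ 0 ω ∈ I} := hσ.measurable 0 (Set.toFinite _).measurableSet
  rw [hI] at hs ⊢
  have hsub : {ω | ((r * ((Real.exp 1 * C + 1) * M * Real.log M) : ℝ) : EReal) <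
      ((hitTime fun k => S k ω : ℕ∞) : EReal)} ⊆ {ω | ∀ k ≤ n, σ k ω ∉ central M} := by
    intro ω hω k hk hmem
    simp only [Set.mem_ofPred_eq] at hω
    have hle : hitTime (fun k => S k ω) ≤ (k : ℕ∞) := by
      refine iInf₂_le k ?_
      simp only [hS]; exact hmem
    have hle' : ((hitTime fun k => S k ω : ℕ∞) : EReal) ≤ ((k : ℝ) : EReal) := by
      have : ((hitTime fun k => S k ω : ℕ∞) : EReal) ≤ (((k : ℕ∞) : ENNReal) : EReal) := by
        exact_mod_cast hle
      exact this
    have := (hω.trans_le hle')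
    rw [EReal.coe_lt_coe_iff] at this
    have hk' : (k : ℝ) ≤ n := by exact_mod_cast hk
    linarith
  have hpos : 0 < μ.real {ω | σ 0 ω ∈ I} := by
    rw [measureReal_def]
    exact ENNReal.toReal_pos hs (measure_ne_top _ _)
  refine (measureReal_mono hsub).trans ?_
  rw [measureReal_def, cond_apply hImeas, ENNReal.toReal_mul, ENNReal.toReal_inv,
    ← measureReal_def, ← measureReal_def]
  have hset : {ω | σ 0 ω ∈ I} ∩ {ω | ∀ k ≤ n, σ k ω ∉ central M} =
      {ω | σ 0 ω ∈ I ∧ ∀ k ≤ n, σ k ω ∉ central M} := rfl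
  have hmass : μ.real {ω | σ 0 ω ∈ I} =
      ∑ x ∈ Finset.univ.filter (· ∈ I), μ.real {ω | σ 0 ω = x} := by
    rw [← measureReal_biUnion_finset]
    · congr 1; ext ω; simp
    · intro z _ z' _ hzz
      rw [Function.onFun, Set.disjoint_left]
      intro ω h h'
      exact hzz (Eq.trans (Eq.symm h) h')
    · intro x _; exact hσ.measurable 0 (measurableSet_singleton x)
  rw [hset, hσ.measureReal_avoid, inv_mul_le_iff₀ hpos, hmass, Finset.sum_mul]
  refine Finset.sum_le_sum fun x _ => mul_le_mul_of_nonneg_left ?_ measureReal_nonneg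
  have := avoidProb_le_exp (A := central M) (glauber_nonneg hM0) (sum_glauber hM0) h0 h2 h1
    hTlow ⌊r⌋₊ x
  rw [hn]
  refine this.trans_eq ?_
  rw [natCast_floor_eq_intCast_floor hr]

/-! ### Mean-field drift, potential and fixed points. -/

/-- The mean-field drift of the magnetisation chain. -/
def drift (s : Fin 3 → ℝ) (k : Fin 3) : ℝ := softmax s k - s k

/-- Squared Euclidean norm of the drift. -/
def driftSq (s : Fin 3 → ℝ) : ℝ := ∑ k, drift s k ^ 2

/-- The saddle points of the mean-field dynamics. -/
def saddle (i k : Fin 3) : ℝ := if k = i then 1 / 2 else 1 / 4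

/-- The potential of which the drift is, up to a factor, the negative gradient. -/
def potential (s : Fin 3 → ℝ) : ℝ :=
  slope / 2 * ∑ k, s k ^ 2 - Real.log (∑ k, Real.exp (slope * s k))

theorem slope_bounds : 2.7725 < slope ∧ slope < 2.7726 := by
  have h1 := Real.log_two_gt_d9
  have h2 := Real.log_two_lt_d9
  unfold slope
  constructor <;> linarith

theorem driftSq_nonneg (s : Fin 3 → ℝ) : 0 ≤ driftSq s :=
  Finset.sum_nonneg fun _ _ => sq_nonneg _

theorem saddle_mem (i : Fin 3) : saddle i ∈ stdSimplex ℝ (Fin 3) := by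
  constructor
  · intro k; unfold saddle; split_ifs <;> norm_num
  · fin_cases i <;> simp [Fin.sum_univ_three, saddle] <;> norm_num

theorem exp_slope_half : Real.exp (slope * (1 / 2)) = 4 := by
  have : slope * (1 / 2) = Real.log 4 := by
    rw [show (4 : ℝ) = 2 ^ 2 by norm_num, Real.log_pow]; unfold slope; push_cast; ring
  rw [this, Real.exp_log (by norm_num)]

theorem exp_slope_quarter : Real.exp (slope * (1 / 4)) = 2 := by
  have : slope * (1 / 4) = Real.log 2 := by unfold slope; ring
  rw [this, Real.exp_log (by norm_num)]

theorem sum_exp_saddle (i : Fin 3) : ∑ k, Real.exp (slope * saddle i k) = 8 := by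
  have h2 := exp_slope_half
  have h4 := exp_slope_quarter
  fin_cases i <;> simp only [saddle, Fin.sum_univ_three] <;> simp at h2 h4 ⊢ <;>
    rw [h2, h4] <;> norm_num

theorem softmax_saddle (i k : Fin 3) : softmax (saddle i) k = saddle i k := by
  rw [softmax, sum_exp_saddle]
  unfold saddle
  split_ifs
  · rw [exp_slope_half]; norm_num
  · rw [exp_slope_quarter]; norm_num

theorem drift_saddle (i k : Fin 3) : drift (saddle i) k = 0 := by
  rw [drift, softmax_saddle, sub_self]

theorem potential_saddle (i : Fin 3) : potential (saddle i) = potential (saddle 0) := by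
  unfold potential
  rw [sum_exp_saddle, sum_exp_saddle]
  have h : ∀ i, ∑ k, saddle i k ^ 2 = 3 / 8 := by
    intro i
    fin_cases i <;> simp [saddle, Fin.sum_univ_three] <;> norm_num
  rw [h, h]

/-- The potential satisfies the second order upper bound given by its quadratic part. -/
theorem potential_add_le (s w : Fin 3 → ℝ) :
    potential (s + w) ≤ potential s - slope * ∑ k, drift s k * w k + slope / 2 * ∑ k, w k ^ 2 := by
  have hZ := sum_exp_pos s
  -- Jensen's inequality says that log-sum-exp lies above its tangent. It enters the potential with
  -- a minus sign, so only the exact quadratic part is left as an upper error and no Taylor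
  -- remainder arises.
  have hJ : Real.exp (slope * ∑ k, softmax s k * w k) ≤
      ∑ k, softmax s k * Real.exp (slope * w k) := by
    have h := convexOn_exp.map_sum_le (t := Finset.univ) (w := softmax s)
      (p := fun k => slope * w k) (fun k _ => (softmax_pos s k).le) (sum_softmax s)
      (fun _ _ => Set.mem_univ _)
    simp only [smul_eq_mul] at h
    refine le_of_eq_of_le ?_ h
    rw [Finset.mul_sum]
    exact congrArg Real.exp (Finset.sum_congr rfl fun k _ => by ring)
  have hprod : ∑ k, Real.exp (slope * (s + w) k) =
      (∑ k, Real.exp (slope * s k)) * ∑ k, softmax s k * Real.exp (slope * w k) := by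
    rw [Finset.mul_sum]
    refine Finset.sum_congr rfl fun k _ => ?_
    rw [Pi.add_apply, mul_add, Real.exp_add, softmax]
    field_simp
  have hlog : Real.log (∑ k, Real.exp (slope * s k)) + slope * ∑ k, softmax s k * w k ≤
      Real.log (∑ k, Real.exp (slope * (s + w) k)) := by
    rw [hprod, Real.log_mul hZ.ne' ((Real.exp_pos _).trans_le hJ).ne']
    have := Real.log_le_log (Real.exp_pos _) hJ
    rw [Real.log_exp] at this
    linarith
  unfold potential
  have e : slope / 2 * ∑ k, (s + w) k ^ 2 = slope / 2 * ∑ k, s k ^ 2 +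
      slope * ∑ k, s k * w k + slope / 2 * ∑ k, w k ^ 2 := by
    simp only [Fin.sum_univ_three, Pi.add_apply]; ring
  have e' : ∑ k, drift s k * w k = ∑ k, softmax s k * w k - ∑ k, s k * w k := by
    simp only [Fin.sum_univ_three, drift]; ring
  rw [e, e']
  linarith

section FixedPoints

/-- The odd function whose zeros describe the fixed points with two equal coordinates. -/
def oddLog (u : ℝ) : ℝ := Real.log (3 / 4 + u) - Real.log (3 / 4 - u) - slope * u

theorem hasDerivAt_oddLog {u : ℝ} (h1 : -(3 / 4) < u) (h2 : u < 3 / 4) :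
    HasDerivAt oddLog (1 / (3 / 4 + u) + 1 / (3 / 4 - u) - slope) u := by
  have a := ((hasDerivAt_id u).const_add (3 / 4)).log (by simp; linarith)
  have b := ((hasDerivAt_id u).const_sub (3 / 4)).log (by simp; linarith)
  have c := (hasDerivAt_id u).const_mul slope
  refine ((a.sub b).sub c).congr_deriv ?_
  simp only [id]
  ring

theorem oddLog_neg (u : ℝ) : oddLog (-u) = -oddLog u := by
  unfold oddLog
  rw [sub_neg_eq_add, ← sub_eq_add_neg]; ring

theorem oddLog_quarter : oddLog (1 / 4) = 0 := by
  unfold oddLog slope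
  rw [show (3 / 4 - 1 / 4 : ℝ) = 2⁻¹ by norm_num, Real.log_inv]
  norm_num; ring

/-- Together with `0` there would be three zeros, so by Rolle two positive zeros of the derivative;
but these satisfy `slope * (9/16 - z²) = 3/2`, which has at most one positive root. -/
theorem oddLog_no_two_zeros {x y : ℝ} (hx : 0 < x) (hxy : x < y) (hy : y < 3 / 4)
    (hx0 : oddLog x = 0) (hy0 : oddLog y = 0) : False := by
  have h0 : oddLog 0 = 0 := by simp [oddLog]
  have hc : ∀ {p q : ℝ}, 0 ≤ p → p < q → q < 3 / 4 → oddLog p = 0 → oddLog q = 0 →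
      ∃ c ∈ Set.Ioo p q, 1 / (3 / 4 + c) + 1 / (3 / 4 - c) - slope = 0 := by
    intro p q hp hpq hq hp0 hq0
    exact exists_hasDerivAt_eq_zero hpq
      (fun z hz => (hasDerivAt_oddLog (by linarith [hz.1])
        (by linarith [hz.2])).continuousAt.continuousWithinAt) (hp0.trans hq0.symm)
      fun z hz => hasDerivAt_oddLog (by linarith [hz.1]) (by linarith [hz.2])
  obtain ⟨c, hc1, hc2⟩ := hc le_rfl hx (hxy.trans hy) h0 hx0
  obtain ⟨d, hd1, hd2⟩ := hc hx.le hxy hy hx0 hy0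
  have key : ∀ z : ℝ, 0 < z → z < 3 / 4 → 1 / (3 / 4 + z) + 1 / (3 / 4 - z) - slope = 0 →
      slope * (9 / 16 - z ^ 2) = 3 / 2 := by
    intro z h1 h2 h
    have n1 : (3 / 4 + z) * (1 / (3 / 4 + z)) = 1 := mul_one_div_cancel (by linarith)
    have n2 : (3 / 4 - z) * (1 / (3 / 4 - z)) = 1 := mul_one_div_cancel (by linarith)
    have : slope = 1 / (3 / 4 + z) + 1 / (3 / 4 - z) := by linarith
    rw [this]
    linear_combination (3 / 4 - z) * n1 + (3 / 4 + z) * n2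
  have k1 := key c hc1.1 (by linarith [hc1.2]) hc2
  have k2 := key d (hx.trans hd1.1) (by linarith [hd1.2]) hd2
  have : c < d := hc1.2.trans hd1.1
  have hc0 := hc1.1
  nlinarith [slope_pos, mul_pos slope_pos (mul_pos (sub_pos.2 this) (add_pos hc0 (hc0.trans this)))]

theorem oddLog_eq_zero {u : ℝ} (h1 : -(3 / 4) < u) (h2 : u < 3 / 4) (h : oddLog u = 0) :
    u = 0 ∨ u = 1 / 4 ∨ u = -(1 / 4) := by
  have pos : ∀ {z : ℝ}, 0 < z → z < 3 / 4 → oddLog z = 0 → z = 1 / 4 := by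
    intro z hz1 hz2 hz
    rcases lt_trichotomy z (1 / 4) with hlt | heq | hgt
    · exact (oddLog_no_two_zeros hz1 hlt (by norm_num) hz oddLog_quarter).elim
    · exact heq
    · exact (oddLog_no_two_zeros (by norm_num) hgt hz2 oddLog_quarter hz).elim
  rcases lt_trichotomy u 0 with hlt | heq | hgt
  · right; right
    have := pos (z := -u) (by linarith) (by linarith) (by rw [oddLog_neg, h, neg_zero])
    linarith
  · exact Or.inl heq
  · exact Or.inr (Or.inl (pos hgt h2 h))

/-- The function `log t - slope * t` is strictly concave, so it takes no value three times. -/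
theorem log_sub_mul_two_of_three {x y z c : ℝ} (hx : 0 < x) (hy : 0 < y) (hz : 0 < z)
    (hxc : Real.log x - slope * x = c) (hyc : Real.log y - slope * y = c)
    (hzc : Real.log z - slope * z = c) : x = y ∨ y = z ∨ x = z := by
  have key : ∀ {p q r : ℝ}, 0 < p → p < q → q < r → Real.log p - slope * p = c →
      Real.log q - slope * q = c → Real.log r - slope * r = c → False := by
    intro p q r hp hpq hqr h1 h2 h3
    have h := strictConcaveOn_log_Ioi.2 (Set.mem_Ioi.2 hp)
      (Set.mem_Ioi.2 (hp.trans (hpq.trans hqr))) (hpq.trans hqr).ne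
      (div_pos (sub_pos.2 hqr) (sub_pos.2 (hpq.trans hqr)))
      (div_pos (sub_pos.2 hpq) (sub_pos.2 (hpq.trans hqr)))
      (by rw [← add_div, div_eq_one_iff_eq (by linarith)]; ring)
    have e : (r - q) / (r - p) * p + (q - p) / (r - p) * r = q := by
      have : r - p ≠ 0 := by linarith
      field_simp; ring
    simp only [smul_eq_mul] at h
    rw [e, show Real.log p = c + slope * p by linarith,
      show Real.log r = c + slope * r by linarith] at h
    have e2 : (r - q) / (r - p) * (c + slope * p) + (q - p) / (r - p) * (c + slope * r) =
        c + slope * q := by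
      have : r - p ≠ 0 := by linarith
      field_simp; ring
    rw [e2] at h
    linarith
  by_contra! hne
  obtain ⟨h1, h2, h3⟩ := hne
  rcases lt_or_gt_of_ne h1 with a | a <;> rcases lt_or_gt_of_ne h2 with b | b <;>
    rcases lt_or_gt_of_ne h3 with d | d
  · exact key hx a b hxc hyc hzc
  · linarith
  · exact key hx d b hxc hzc hyc
  · exact key hz d a hzc hxc hyc
  · exact key hy a d hyc hxc hzc
  · exact key hy b d hyc hzc hxc
  · linarith
  · exact key hz b a hzc hyc hxc

/-- With `u = x - y - 1/4` one has `3/4 + u = 3x/2` and `3/4 - u = 3y`. The critical slope makes the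
equation odd in `u`, centred at the saddle; the roots `0, 1/4, -1/4` are the saddle, an outer centre
and the middle centre. -/
theorem fixed_two_equal {x y : ℝ} (hx : 0 < x) (hy : 0 < y) (hsum : x + 2 * y = 1)
    (h : Real.log x - slope * x = Real.log y - slope * y) :
    (x = 1 / 2 ∧ y = 1 / 4) ∨ (x = 2 / 3 ∧ y = 1 / 6) ∨ (x = 1 / 3 ∧ y = 1 / 3) := by
  have hu : oddLog (x - y - 1 / 4) = 0 := by
    unfold oddLog
    rw [show 3 / 4 + (x - y - 1 / 4) = 3 / 2 * x by linarith,
      show 3 / 4 - (x - y - 1 / 4) = 3 * y by linarith,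
      Real.log_mul (by norm_num) hx.ne', Real.log_mul (by norm_num) hy.ne',
      Real.log_div (by norm_num) (by norm_num)]
    have : slope * (1 / 4) = Real.log 2 := by unfold slope; ring
    linarith
  rcases oddLog_eq_zero (by linarith) (by linarith) hu with h | h | h
  · left; constructor <;> linarith
  · right; left; constructor <;> linarith
  · right; right; constructor <;> linarith

/-- At a fixed point of softmax all coordinates are positive and `log (s k) - slope * s k` does not
depend on `k`, so two coordinates coincide. -/
theorem drift_eq_zero {s : Fin 3 → ℝ} (hs : ∑ k, s k = 1) (h : ∀ k, drift s k = 0) :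
    (∃ i, s = saddle i) ∨ ∃ j, s = centre j := by
  have hfix : ∀ k, softmax s k = s k := fun k => by have := h k; unfold drift at this; linarith
  have hpos : ∀ k, 0 < s k := fun k => hfix k ▸ softmax_pos s k
  have hlog : ∀ k, Real.log (s k) - slope * s k = -Real.log (∑ j, Real.exp (slope * s j)) := by
    intro k
    conv_lhs => rw [← hfix k]
    rw [softmax, Real.log_div (Real.exp_pos _).ne' (sum_exp_pos s).ne', Real.log_exp,
      ← softmax, hfix k]
    ring
  rw [Fin.sum_univ_three] at hs
  have l0 := hlog 0
  have l1 := hlog 1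
  have l2 := hlog 2
  have p0 := hpos 0
  have p1 := hpos 1
  have p2 := hpos 2
  rcases log_sub_mul_two_of_three p0 p1 p2 l0 l1 l2 with e | e | e
  · rcases fixed_two_equal p2 p0 (by linarith) (l2.trans l0.symm) with ⟨a, b⟩ | ⟨a, b⟩ | ⟨a, b⟩
    · left; refine ⟨2, ?_⟩; ext k; fin_cases k <;> simp [saddle] <;> linarith
    · right; refine ⟨2, ?_⟩; ext k; fin_cases k <;> simp [centre] <;> linarith
    · right; refine ⟨3, ?_⟩; ext k; fin_cases k <;> simp [centre] <;> linarith
  · rcases fixed_two_equal p0 p1 (by linarith) (l0.trans l1.symm) with ⟨a, b⟩ | ⟨a, b⟩ | ⟨a, b⟩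
    · left; refine ⟨0, ?_⟩; ext k; fin_cases k <;> simp [saddle] <;> linarith
    · right; refine ⟨0, ?_⟩; ext k; fin_cases k <;> simp [centre] <;> linarith
    · right; refine ⟨3, ?_⟩; ext k; fin_cases k <;> simp [centre] <;> linarith
  · rcases fixed_two_equal p1 p0 (by linarith) (l1.trans l0.symm) with ⟨a, b⟩ | ⟨a, b⟩ | ⟨a, b⟩
    · left; refine ⟨1, ?_⟩; ext k; fin_cases k <;> simp [saddle] <;> linarith
    · right; refine ⟨1, ?_⟩; ext k; fin_cases k <;> simp [centre] <;> linarith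
    · right; refine ⟨3, ?_⟩; ext k; fin_cases k <;> simp [centre] <;> linarith

theorem centreDist_centre (j : Fin 4) : centreDist (centre j) = 0 := by
  have h0 : ∀ s, 0 ≤ centreDist s := fun s => by
    unfold centreDist triDist; positivity
  have h : triDist (centre j) (centre j) = 0 := by simp [triDist]
  refine le_antisymm ?_ (h0 _)
  rw [← h]
  unfold centreDist
  fin_cases j <;> simp

end FixedPoints

/-! ### Linearisation at the saddles and a lower bound for the drift. -/

theorem softmax_eq_exp (s : Fin 3 → ℝ) (k : Fin 3) :
    softmax s k = Real.exp (slope * s k - Real.log (∑ j, Real.exp (slope * s j))) := by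
  rw [Real.exp_sub, Real.exp_log (sum_exp_pos s), softmax]

/-- The derivative of `softmax · k` at `s`. -/
def softmaxDeriv (s : Fin 3 → ℝ) (k : Fin 3) : (Fin 3 → ℝ) →L[ℝ] ℝ :=
  softmax s k • (slope • ContinuousLinearMap.proj (R := ℝ) (φ := fun _ : Fin 3 => ℝ) k -
    (∑ j, Real.exp (slope * s j))⁻¹ • ∑ j, Real.exp (slope * s j) •
      (slope • ContinuousLinearMap.proj (R := ℝ) (φ := fun _ : Fin 3 => ℝ) j))

theorem softmaxDeriv_apply (s w : Fin 3 → ℝ) (k : Fin 3) :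
    softmaxDeriv s k w = slope * softmax s k * (w k - ∑ j, softmax s j * w j) := by
  simp only [softmaxDeriv, _root_.smul_apply, _root_.sub_apply,
    _root_.sum_apply, ContinuousLinearMap.proj_apply, smul_eq_mul]
  have : (∑ j, Real.exp (slope * s j))⁻¹ * ∑ j, Real.exp (slope * s j) * (slope * w j) =
      slope * ∑ j, softmax s j * w j := by
    rw [Finset.mul_sum, Finset.mul_sum]
    exact Finset.sum_congr rfl fun j _ => by rw [softmax]; ring
  rw [this]; ring

theorem hasFDerivAt_softmax (s : Fin 3 → ℝ) (k : Fin 3) :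
    HasFDerivAt (fun s => softmax s k) (softmaxDeriv s k) s := by
  have hp : ∀ j : Fin 3, HasFDerivAt (fun s : Fin 3 → ℝ => slope * s j)
      (slope • ContinuousLinearMap.proj (R := ℝ) (φ := fun _ : Fin 3 => ℝ) j) s :=
    fun j => (hasFDerivAt_apply j s).const_mul slope
  have hZ := (HasFDerivAt.fun_sum (u := Finset.univ) fun j _ => (hp j).exp).log (sum_exp_pos s).ne'
  have h := ((hp k).fun_sub hZ).exp
  simp only [← softmax_eq_exp] at h
  exact h

theorem continuous_softmax (k : Fin 3) : Continuous fun s => softmax s k :=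
  continuous_iff_continuousAt.2 fun s => (hasFDerivAt_softmax s k).continuousAt

theorem contDiff_softmax (k : Fin 3) : ContDiff ℝ 1 fun s => softmax s k := by
  unfold softmax
  refine ContDiff.div ?_ ?_ fun s => (sum_exp_pos s).ne'
  · fun_prop
  · fun_prop

/-- Stated on a ball rather than on the simplex because the Glauber update evaluates softmax at the
magnetisation with one spin removed. -/
theorem exists_softmax_lipschitz : ∃ L : ℝ, 0 < L ∧ ∀ s t : Fin 3 → ℝ, ‖s‖ ≤ 2 → ‖t‖ ≤ 2 →
    ∀ k, |softmax s k - softmax t k| ≤ L * ‖s - t‖ := by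
  have h : ∀ k, ∃ K, LipschitzOnWith K (fun s => softmax s k)
      (Metric.closedBall (0 : Fin 3 → ℝ) 2) := fun k =>
    (contDiff_softmax k).contDiffOn.exists_lipschitzOnWith one_ne_zero (convex_closedBall _ _)
      (isCompact_closedBall _ _)
  choose K hK using h
  refine ⟨∑ k, (K k : ℝ) + 1, by positivity, fun s t hs ht k => ?_⟩
  have h1 := (hK k).dist_le_mul s (by simpa using hs) t (by simpa using ht)
  rw [Real.dist_eq, dist_eq_norm] at h1
  refine h1.trans (mul_le_mul_of_nonneg_right ?_ (norm_nonneg _))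
  have := Finset.single_le_sum (f := fun k => (K k : ℝ)) (fun i _ => (K i).2) (Finset.mem_univ k)
  linarith

/-- First order expansion of the drift at a saddle. -/
theorem drift_near_saddle (i : Fin 3) {κ : ℝ} (hκ : 0 < κ) : ∃ r > 0, ∀ s : Fin 3 → ℝ,
    ∑ k, s k = 1 → ‖s - saddle i‖ ≤ r →
      |drift s i - (3 / 8 * slope - 1) * (s i - saddle i i)| ≤ κ * ‖s - saddle i‖ ∧
      ∀ k ≠ i, |drift s k - ((slope / 4 - 1) * (s k - saddle i k) -
        slope / 16 * (s i - saddle i i))| ≤ κ * ‖s - saddle i‖ := by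
  have h : ∀ k, ∃ r > 0, ∀ s : Fin 3 → ℝ, ‖s - saddle i‖ ≤ r →
      |softmax s k - saddle i k - slope * saddle i k * ((s - saddle i) k -
        ∑ j, saddle i j * (s - saddle i) j)| ≤ κ * ‖s - saddle i‖ := by
    intro k
    have h1 := ((hasFDerivAt_softmax (saddle i) k).isLittleO.def hκ)
    obtain ⟨r, hr, hball⟩ := Metric.eventually_nhds_iff.1 h1
    refine ⟨r / 2, by positivity, fun s hs => ?_⟩
    have := hball (y := s) (by rw [dist_eq_norm]; linarith)
    simpa only [softmaxDeriv_apply, softmax_saddle, Real.norm_eq_abs] using this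
  choose r hr hrs using h
  refine ⟨min (r 0) (min (r 1) (r 2)), by simp [hr], fun s hs hsr => ?_⟩
  have hall : ∀ k, ‖s - saddle i‖ ≤ r k := by
    simp only [le_min_iff] at hsr
    intro k; fin_cases k
    · exact hsr.1
    · exact hsr.2.1
    · exact hsr.2.2
  -- The saddle is `1/4` in every coordinate plus `1/4` at `i`, and `s - saddle i` sums to zero.
  have hmean : ∑ j, saddle i j * (s - saddle i) j = (s i - saddle i i) / 4 := by
    have h2 := (saddle_mem i).2
    have e : ∀ j, saddle i j * (s - saddle i) j =
        1 / 4 * (s j - saddle i j) + if j = i then 1 / 4 * (s j - saddle i j) else 0 := by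
      intro j
      by_cases hj : j = i
      · simp [saddle, hj]; ring
      · simp [saddle, hj]
    simp_rw [e, Finset.sum_add_distrib, ← Finset.mul_sum, Finset.sum_sub_distrib]
    rw [hs, h2]; simp; ring
  have hii : saddle i i = 1 / 2 := by simp [saddle]
  constructor
  · have := hrs i s (hall i)
    rw [hmean] at this
    refine le_of_eq_of_le (congrArg abs ?_) this
    simp only [drift, Pi.sub_apply, hii]; ring
  · intro k hk
    have := hrs k s (hall k)
    rw [hmean] at this
    refine le_of_eq_of_le (congrArg abs ?_) this
    have hik : saddle i k = 1 / 4 := by simp [saddle, hk]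
    simp only [drift, Pi.sub_apply, hii, hik]; ring

/-- The drift vanishes at most linearly at a saddle. -/
theorem driftSq_near_saddle (i : Fin 3) : ∃ r > 0, ∀ s : Fin 3 → ℝ, ∑ k, s k = 1 →
    ‖s - saddle i‖ ≤ r → 1 / 10 ^ 6 * ‖s - saddle i‖ ^ 2 ≤ driftSq s := by
  obtain ⟨r, hr, h⟩ := drift_near_saddle i (κ := 1 / 1000) (by norm_num)
  refine ⟨r, hr, fun s hs hsr => ?_⟩
  obtain ⟨h1, h2⟩ := h s hs hsr
  set d := ‖s - saddle i‖ with hd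
  have hd0 : 0 ≤ d := norm_nonneg _
  obtain ⟨sl1, sl2⟩ := slope_bounds
  suffices ∃ k, 1 / 1000 * d ≤ |drift s k| by
    obtain ⟨k, hk⟩ := this
    have h3 : drift s k ^ 2 ≤ driftSq s :=
      Finset.single_le_sum (f := fun k => drift s k ^ 2) (fun _ _ => sq_nonneg _)
        (Finset.mem_univ k)
    have h4 : (1 / 1000 * d) ^ 2 ≤ |drift s k| ^ 2 := by gcongr
    rw [sq_abs] at h4
    nlinarith
  -- The unstable rate `3/8 * slope - 1` is about `0.0397`, so a displacement of `d / 8` at `i`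
  -- still beats the error `d / 1000`. Otherwise a coordinate `k ≠ i` has displacement `d`, and the
  -- stable rate `1 - slope / 4` beats the coupling to coordinate `i`.
  by_cases hx : d / 8 ≤ |s i - saddle i i|
  · refine ⟨i, ?_⟩
    have h5 : (3 / 8 * slope - 1) * |s i - saddle i i| - |drift s i| ≤
        |drift s i - (3 / 8 * slope - 1) * (s i - saddle i i)| := by
      have := abs_sub_abs_le_abs_sub ((3 / 8 * slope - 1) * (s i - saddle i i)) (drift s i)
      rw [abs_mul, abs_of_pos (by linarith : 0 < 3 / 8 * slope - 1)] at this
      rwa [abs_sub_comm _ (drift s i)] at this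
    nlinarith
  · push Not at hx
    have hex : ∃ k, ‖(s - saddle i) k‖ = d := by
      obtain ⟨k, hk⟩ := Finite.exists_max fun k => ‖(s - saddle i) k‖
      exact ⟨k, le_antisymm (norm_le_pi_norm _ k)
        ((pi_norm_le_iff_of_nonneg (norm_nonneg _)).2 hk)⟩
    obtain ⟨k, hk⟩ := hex
    rw [Real.norm_eq_abs, Pi.sub_apply] at hk
    by_cases hki : k = i
    · subst hki
      refine ⟨k, ?_⟩
      have := abs_nonneg (drift s k)
      linarith
    · refine ⟨k, ?_⟩
      have h3 := h2 k hki
      have e1 := abs_sub_abs_le_abs_sub ((1 - slope / 4) * (s k - saddle i k))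
        (-(drift s k + slope / 16 * (s i - saddle i i)))
      rw [abs_mul, abs_of_pos (by linarith : 0 < 1 - slope / 4), hk, abs_neg] at e1
      have e2 := abs_add_le (drift s k) (slope / 16 * (s i - saddle i i))
      rw [abs_mul, abs_of_pos (by linarith : 0 < slope / 16)] at e2
      have e3 : (1 - slope / 4) * (s k - saddle i k) -
          -(drift s k + slope / 16 * (s i - saddle i i)) = drift s k -
          ((slope / 4 - 1) * (s k - saddle i k) - slope / 16 * (s i - saddle i i)) := by ring
      rw [e3] at e1
      nlinarith

theorem norm_sub_saddle_le {s : Fin 3 → ℝ} (hs : s ∈ stdSimplex ℝ (Fin 3)) (i : Fin 3) :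
    ‖s - saddle i‖ ≤ 1 := by
  rw [pi_norm_le_iff_of_nonneg zero_le_one]
  intro k
  have h1 := hs.1 k
  have h2 : s k ≤ 1 := by
    rw [← hs.2]; exact Finset.single_le_sum (fun j _ => hs.1 j) (Finset.mem_univ k)
  rw [Real.norm_eq_abs, Pi.sub_apply, abs_le]
  unfold saddle
  split_ifs <;> constructor <;> linarith

theorem continuous_driftSq : Continuous driftSq := by
  unfold driftSq drift
  have := continuous_softmax
  fun_prop

theorem continuous_centreDist : Continuous centreDist := by
  unfold centreDist triDist
  fun_prop

/-- Outside the central region the drift is bounded below by the distance to the nearest saddle. -/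
theorem exists_driftSq_lower : ∃ c : ℝ, 0 < c ∧ ∀ s ∈ stdSimplex ℝ (Fin 3),
    rho / 2 ≤ centreDist s → ∃ i, (∀ j, ‖s - saddle i‖ ≤ ‖s - saddle j‖) ∧
      c * ‖s - saddle i‖ ^ 2 ≤ driftSq s := by
  choose r hr hloc using driftSq_near_saddle
  have hrho : (0 : ℝ) < rho / 2 := by norm_num [rho]
  -- Away from all saddles and centres the drift has no zero, so compactness gives a positive
  -- minimum; near a saddle the linearisation takes over.
  let K : Set (Fin 3 → ℝ) := stdSimplex ℝ (Fin 3) ∩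
    ({s | rho / 2 ≤ centreDist s} ∩ ⋂ i, {s | r i ≤ ‖s - saddle i‖})
  have hK : IsCompact K := by
    refine (isCompact_stdSimplex ℝ (Fin 3)).inter_right (IsClosed.inter ?_ ?_)
    · exact isClosed_le continuous_const continuous_centreDist
    · exact isClosed_iInter fun i => isClosed_le continuous_const (by fun_prop)
  have hpos : ∀ s ∈ K, 0 < driftSq s := by
    rintro s ⟨hs, hc, hfar⟩
    refine lt_of_le_of_ne (driftSq_nonneg s) fun h0 => ?_
    have hz : ∀ k, drift s k = 0 := by
      have := (Finset.sum_eq_zero_iff_of_nonneg fun k _ => sq_nonneg (drift s k)).1 h0.symm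
      intro k
      exact pow_eq_zero_iff two_ne_zero |>.1 (this k (Finset.mem_univ k))
    rcases drift_eq_zero hs.2 hz with ⟨i, rfl⟩ | ⟨j, rfl⟩
    · have := Set.mem_iInter.1 hfar i
      simp only [Set.mem_ofPred_eq, sub_self, norm_zero] at this
      linarith [hr i]
    · simp only [Set.mem_ofPred_eq, centreDist_centre] at hc
      linarith
  obtain ⟨m, hm, hmK⟩ := hK.exists_forall_le' continuous_driftSq.continuousOn hpos
  refine ⟨min (1 / 10 ^ 6) m, lt_min (by norm_num) hm, fun s hs hc => ?_⟩
  obtain ⟨i, hi⟩ := Finite.exists_min fun i => ‖s - saddle i‖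
  refine ⟨i, hi, ?_⟩
  by_cases hfar : s ∈ K
  · have h1 := hmK s hfar
    have h2 := norm_sub_saddle_le hs i
    have h3 : ‖s - saddle i‖ ^ 2 ≤ 1 := by
      have := norm_nonneg (s - saddle i); nlinarith
    calc _ ≤ m * 1 := mul_le_mul (min_le_right _ _) h3 (sq_nonneg _) hm.le
      _ ≤ _ := by linarith
  · have : ∃ j, ‖s - saddle j‖ < r j := by
      by_contra! hcon
      exact hfar ⟨hs, hc, Set.mem_iInter.2 hcon⟩
    obtain ⟨j, hj⟩ := this
    have h1 := hloc j s hs.2 hj.le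
    have h2 : ‖s - saddle i‖ ^ 2 ≤ ‖s - saddle j‖ ^ 2 := by
      have := hi j; gcongr
    calc _ ≤ 1 / 10 ^ 6 * ‖s - saddle j‖ ^ 2 :=
          mul_le_mul (min_le_left _ _) h2 (sq_nonneg _) (by norm_num)
      _ ≤ _ := h1

/-! ### One-step laws on the simplex and their means. -/

section WeightedMean

variable {ι : Type*} [Fintype ι]

/-- Weighted mean of a function on a finite type. -/
def wmean (w f : ι → ℝ) : ℝ := ∑ i, w i * f i

theorem wmean_add (w f g : ι → ℝ) : wmean w (fun i => f i + g i) = wmean w f + wmean w g := by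
  simp [wmean, mul_add, Finset.sum_add_distrib]

theorem wmean_mul (w : ι → ℝ) (c : ℝ) (f : ι → ℝ) :
    wmean w (fun i => c * f i) = c * wmean w f := by
  rw [wmean, wmean, Finset.mul_sum]
  exact Finset.sum_congr rfl fun i _ => by ring

theorem wmean_const {w : ι → ℝ} (hw : ∑ i, w i = 1) (c : ℝ) : wmean w (fun _ => c) = c := by
  rw [wmean, ← Finset.sum_mul, hw, one_mul]

theorem wmean_mono {w f g : ι → ℝ} (hw : ∀ i, 0 ≤ w i) (h : ∀ i, f i ≤ g i) :
    wmean w f ≤ wmean w g :=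
  Finset.sum_le_sum fun i _ => mul_le_mul_of_nonneg_left (h i) (hw i)

end WeightedMean

/-- The one-step law of a Markov chain on the simplex at `s`: increment `δ • v i` with probability
`w i`, with mean increment close to the mean-field drift and non-degenerate coordinates. -/
structure IsStep (L δ : ℝ) (s : Fin 3 → ℝ) {ι : Type} [Fintype ι] (w : ι → ℝ)
    (v : ι → Fin 3 → ℝ) : Prop where
  mem : s ∈ stdSimplex ℝ (Fin 3)
  mem_add : ∀ i, s + δ • v i ∈ stdSimplex ℝ (Fin 3)
  nonneg : ∀ i, 0 ≤ w i
  sum_one : ∑ i, w i = 1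
  bound : ∀ i k, |v i k| ≤ 1
  mean : ∀ k, |wmean w (fun i => v i k) - drift s k| ≤ L * δ
  var : ∀ k, 1 / 48 ≤ wmean w fun i => v i k ^ 2

theorem norm_le_one_of_mem {s : Fin 3 → ℝ} (hs : s ∈ stdSimplex ℝ (Fin 3)) : ‖s‖ ≤ 1 := by
  rw [pi_norm_le_iff_of_nonneg zero_le_one]
  intro k
  rw [Real.norm_eq_abs, abs_of_nonneg (hs.1 k), ← hs.2]
  exact Finset.single_le_sum (fun j _ => hs.1 j) (Finset.mem_univ k)

theorem abs_drift_le_sqrt (s : Fin 3 → ℝ) (k : Fin 3) : |drift s k| ≤ √(driftSq s) :=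
  Real.abs_le_sqrt (Finset.single_le_sum (f := fun k => drift s k ^ 2) (fun _ _ => sq_nonneg _)
    (Finset.mem_univ k))

theorem abs_drift_le_one {s : Fin 3 → ℝ} (hs : s ∈ stdSimplex ℝ (Fin 3)) (k : Fin 3) :
    |drift s k| ≤ 1 := by
  have h1 := softmax_pos s k
  have h2 : softmax s k ≤ 1 := by
    rw [← sum_softmax s]
    exact Finset.single_le_sum (fun j _ => (softmax_pos s j).le) (Finset.mem_univ k)
  have h3 := hs.1 k
  have h4 : s k ≤ 1 := by
    rw [← hs.2]; exact Finset.single_le_sum (fun j _ => hs.1 j) (Finset.mem_univ k)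
  unfold drift
  rw [abs_le]; constructor <;> linarith

theorem exists_drift_lipschitz : ∃ D : ℝ, 0 < D ∧ ∀ s ∈ stdSimplex ℝ (Fin 3),
    ∀ t ∈ stdSimplex ℝ (Fin 3), ∀ k, |drift s k - drift t k| ≤ D * ‖s - t‖ := by
  obtain ⟨L, hL, h⟩ := exists_softmax_lipschitz
  refine ⟨L + 1, by positivity, fun s hs t ht k => ?_⟩
  have h1 := h s t (by linarith [norm_le_one_of_mem hs]) (by linarith [norm_le_one_of_mem ht]) k
  have h2 := norm_le_pi_norm (s - t) k
  rw [Real.norm_eq_abs, Pi.sub_apply] at h2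
  have h3 : drift s k - drift t k = (softmax s k - softmax t k) + -(s k - t k) := by
    unfold drift; ring
  rw [h3]
  refine (abs_add_le _ _).trans ?_
  rw [abs_neg]
  linarith

theorem abs_sum_mul_le {x y : Fin 3 → ℝ} {a b : ℝ} (hx : ∀ k, |x k| ≤ a) (hy : ∀ k, |y k| ≤ b) :
    |∑ k, x k * y k| ≤ 3 * (a * b) := by
  refine (Finset.abs_sum_le_sum_abs _ _).trans ?_
  have : ∀ k ∈ Finset.univ, |x k * y k| ≤ a * b := fun k _ => by
    rw [abs_mul]
    exact mul_le_mul (hx k) (hy k) (abs_nonneg _) ((abs_nonneg _).trans (hx k))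
  refine (Finset.sum_le_card_nsmul _ _ _ this).trans ?_
  simp

theorem sum_sq_le {x : Fin 3 → ℝ} {a : ℝ} (hx : ∀ k, |x k| ≤ a) : ∑ k, x k ^ 2 ≤ 3 * a ^ 2 := by
  have := abs_sum_mul_le hx hx
  simp only [← sq] at this
  exact (le_abs_self _).trans this

/-! ### Change of the potential in one step. -/

section Potential

theorem potential_sub_le {s t : Fin 3 → ℝ} {b d : ℝ} (hb : ∀ k, |drift s k| ≤ b)
    (hd : ∀ k, |t k - s k| ≤ d) :
    potential t - potential s ≤ slope * (3 * (b * d)) + slope / 2 * (3 * d ^ 2) := by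
  have h := potential_add_le s (t - s)
  rw [add_sub_cancel] at h
  have h1 := abs_le.1 (abs_sum_mul_le (y := t - s) hb hd)
  have h2 := sum_sq_le (x := t - s) hd
  have := slope_pos
  nlinarith [mul_le_mul_of_nonneg_left h1.1 this.le, mul_le_mul_of_nonneg_left h2 this.le]

/-- Following the drift gains `slope * δ * driftSq s`. The loss is `3 L` from the mean being off by
`L δ` in each coordinate, and `3/2` from the quadratic term of an increment with entries at most
`δ`. -/
theorem potential_step_mean {L δ : ℝ} {s : Fin 3 → ℝ} {ι : Type} [Fintype ι] {w : ι → ℝ}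
    {v : ι → Fin 3 → ℝ} (hδ : 0 < δ) (h : IsStep L δ s w v) :
    wmean w (fun i => potential (s + δ • v i) - potential s) ≤
      -(slope * δ * driftSq s) + slope * (3 * L + 3 / 2) * δ ^ 2 := by
  have h1 : ∀ i, potential (s + δ • v i) - potential s ≤
      ((-(slope * δ * drift s 0) * v i 0 + -(slope * δ * drift s 1) * v i 1) +
        -(slope * δ * drift s 2) * v i 2) + slope * (3 / 2) * δ ^ 2 := by
    intro i
    have h2 := potential_add_le s (δ • v i)
    have h3 := sum_sq_le (x := δ • v i) (a := δ) (fun k => by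
      rw [Pi.smul_apply, smul_eq_mul, abs_mul, abs_of_pos hδ]
      have := h.bound i k
      nlinarith)
    have h4 := mul_le_mul_of_nonneg_left h3 slope_pos.le
    simp only [Fin.sum_univ_three, Pi.smul_apply, smul_eq_mul] at h2 h4 ⊢
    linarith
  refine (wmean_mono h.nonneg h1).trans ?_
  rw [wmean_add, wmean_add, wmean_add, wmean_mul, wmean_mul, wmean_mul, wmean_const h.sum_one]
  have h5 := abs_le.1 (abs_sum_mul_le (x := drift s)
    (y := fun k => wmean w (fun i => v i k) - drift s k) (abs_drift_le_one h.mem) h.mean)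
  have h6 := mul_le_mul_of_nonneg_left h5.1 (mul_pos slope_pos hδ).le
  simp only [Fin.sum_univ_three, driftSq] at h6 ⊢
  nlinarith

/-- The one-sided second order bound is applied from both endpoints; the Lipschitz constant `D`
transfers the bound on the drift from `s` to `t`. -/
theorem potential_sub_abs_le {D : ℝ} (hD : 0 < D) (hlip : ∀ s ∈ stdSimplex ℝ (Fin 3),
      ∀ t ∈ stdSimplex ℝ (Fin 3), ∀ k, |drift s k - drift t k| ≤ D * ‖s - t‖)
    {s t : Fin 3 → ℝ} (hs : s ∈ stdSimplex ℝ (Fin 3)) (ht : t ∈ stdSimplex ℝ (Fin 3))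
    {b d : ℝ} (hb : ∀ k, |drift s k| ≤ b) (hd : ‖t - s‖ ≤ d) :
    |potential t - potential s| ≤ slope * (3 * b * d + (3 * D + 3 / 2) * d ^ 2) := by
  have hd0 : 0 ≤ d := (norm_nonneg _).trans hd
  have hk : ∀ k, |t k - s k| ≤ d := fun k => (norm_le_pi_norm (t - s) k).trans hd
  have hk' : ∀ k, |s k - t k| ≤ d := fun k => by rw [abs_sub_comm]; exact hk k
  have hb' : ∀ k, |drift t k| ≤ b + D * d := fun k => by
    have h1 := (hlip t ht s hs k).trans (mul_le_mul_of_nonneg_left hd hD.le)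
    have h2 := abs_sub_abs_le_abs_sub (drift t k) (drift s k)
    linarith [hb k]
  have h1 := potential_sub_le hb hk
  have h2 := potential_sub_le hb' hk'
  have := slope_pos
  have h3 : 0 ≤ slope * (D * d ^ 2) := by positivity
  rw [abs_le]
  constructor <;> nlinarith

end Potential

/-! ### Bumps at the saddles. -/

section Bump

/-- An elliptic squared distance to the saddle `i`, stretched along its unstable direction. -/
def ellDist (ε : ℝ) (i : Fin 3) (s : Fin 3 → ℝ) : ℝ :=
  (s i - saddle i i) ^ 2 + ε * ∑ k, (s k - saddle i k) ^ 2

/-- The height variable of the bump at the saddle `i`. -/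
def height (ε η : ℝ) (i : Fin 3) (s : Fin 3 → ℝ) : ℝ := max 0 (1 - ellDist ε i s / η)

/-- A bump supported near the saddle `i`. -/
def bump (ε η : ℝ) (i : Fin 3) (s : Fin 3 → ℝ) : ℝ := η / 2 * height ε η i s ^ 2

variable {ε η : ℝ} {i : Fin 3} {s : Fin 3 → ℝ}

theorem ellDist_lower (hε : 0 ≤ ε) : ε * ‖s - saddle i‖ ^ 2 ≤ ellDist ε i s := by
  obtain ⟨k, hk⟩ := Finite.exists_max fun k => ‖(s - saddle i) k‖
  have h1 : ‖s - saddle i‖ ≤ ‖(s - saddle i) k‖ :=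
    (pi_norm_le_iff_of_nonneg (norm_nonneg _)).2 hk
  have h2 : ‖s - saddle i‖ ^ 2 ≤ (s k - saddle i k) ^ 2 := by
    rw [← sq_abs (s k - saddle i k)]
    exact pow_le_pow_left₀ (norm_nonneg _) h1 2
  have h3 : (s k - saddle i k) ^ 2 ≤ ∑ k, (s k - saddle i k) ^ 2 :=
    Finset.single_le_sum (f := fun k => (s k - saddle i k) ^ 2) (fun _ _ => sq_nonneg _)
      (Finset.mem_univ k)
  unfold ellDist
  nlinarith [sq_nonneg (s i - saddle i i), mul_le_mul_of_nonneg_left (h2.trans h3) hε]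

theorem abs_sub_saddle_le (s : Fin 3 → ℝ) (i k : Fin 3) : |s k - saddle i k| ≤ ‖s - saddle i‖ :=
  norm_le_pi_norm (s - saddle i) k

theorem ellDist_nonneg (hε : 0 ≤ ε) : 0 ≤ ellDist ε i s :=
  (mul_nonneg hε (sq_nonneg _)).trans (ellDist_lower hε)

theorem ellDist_upper (hε : 0 ≤ ε) (hε1 : ε ≤ 1) : ellDist ε i s ≤ 4 * ‖s - saddle i‖ ^ 2 := by
  have h1 := sum_sq_le (x := fun k => s k - saddle i k) (abs_sub_saddle_le s i)
  have h2 : (s i - saddle i i) ^ 2 ≤ ‖s - saddle i‖ ^ 2 := by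
    rw [← sq_abs]; exact pow_le_pow_left₀ (abs_nonneg _) (abs_sub_saddle_le s i i) 2
  unfold ellDist
  nlinarith [mul_le_mul_of_nonneg_left h1 hε, sq_nonneg (‖s - saddle i‖)]

theorem height_mem (hε : 0 ≤ ε) (hη : 0 < η) : 0 ≤ height ε η i s ∧ height ε η i s ≤ 1 := by
  refine ⟨le_max_left _ _, max_le zero_le_one ?_⟩
  have : 0 ≤ ellDist ε i s / η := div_nonneg (ellDist_nonneg hε) hη.le
  linarith

/-- The squared positive part is convex, hence above its tangents, and exceeds a tangent by at most
the square of the displacement. -/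
theorem max_sub_sq_bounds (a d : ℝ) :
    max 0 a ^ 2 - 2 * max 0 a * d ≤ max 0 (a - d) ^ 2 ∧
      max 0 (a - d) ^ 2 ≤ max 0 a ^ 2 - 2 * max 0 a * d + d ^ 2 := by
  rcases le_total 0 a with ha | ha <;> rcases le_total 0 (a - d) with hd | hd <;>
    simp only [max_eq_left, max_eq_right, ha, hd] <;> constructor <;> nlinarith [sq_nonneg d]

/-- As a function of `ellDist` the bump has derivative `-height`, and its second order error is
controlled even where the bump meets zero. -/
theorem bump_sub_bounds (hη : 0 < η) (t : Fin 3 → ℝ) :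
    -(height ε η i s * (ellDist ε i t - ellDist ε i s)) ≤ bump ε η i t - bump ε η i s ∧
    bump ε η i t - bump ε η i s ≤ -(height ε η i s * (ellDist ε i t - ellDist ε i s)) +
      (ellDist ε i t - ellDist ε i s) ^ 2 / (2 * η) := by
  have h := max_sub_sq_bounds (1 - ellDist ε i s / η) ((ellDist ε i t - ellDist ε i s) / η)
  have e : 1 - ellDist ε i s / η - (ellDist ε i t - ellDist ε i s) / η = 1 - ellDist ε i t / η := by
    ring
  rw [e] at h
  change height ε η i s ^ 2 - 2 * height ε η i s * _ ≤ height ε η i t ^ 2 ∧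
    height ε η i t ^ 2 ≤ height ε η i s ^ 2 - 2 * height ε η i s * _ + _ at h
  unfold bump
  have h1 := mul_le_mul_of_nonneg_left h.1 (by positivity : 0 ≤ η / 2)
  have h2 := mul_le_mul_of_nonneg_left h.2 (by positivity : 0 ≤ η / 2)
  have e1 : η / 2 * (height ε η i s ^ 2 - 2 * height ε η i s *
      ((ellDist ε i t - ellDist ε i s) / η)) = η / 2 * height ε η i s ^ 2 -
      height ε η i s * (ellDist ε i t - ellDist ε i s) := by field_simp
  have e2 : η / 2 * (height ε η i s ^ 2 - 2 * height ε η i s *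
      ((ellDist ε i t - ellDist ε i s) / η) + ((ellDist ε i t - ellDist ε i s) / η) ^ 2) =
      η / 2 * height ε η i s ^ 2 -
      height ε η i s * (ellDist ε i t - ellDist ε i s) +
      (ellDist ε i t - ellDist ε i s) ^ 2 / (2 * η) := by field_simp
  rw [e1] at h1
  rw [e2] at h2
  constructor <;> linarith

theorem bump_eq_zero (hε : 0 < ε) (hη : 0 < η) (hηε : η ≤ ε / 256)
    (h : 1 / 16 ≤ ‖s - saddle i‖) : bump ε η i s = 0 := by
  have h1 := ellDist_lower (s := s) (i := i) hε.le
  have h2 : (1 / 16 : ℝ) ^ 2 ≤ ‖s - saddle i‖ ^ 2 := by gcongr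
  have h3 : η ≤ ellDist ε i s := by nlinarith
  have h4 : height ε η i s = 0 := by
    refine max_eq_left ?_
    have : 1 ≤ ellDist ε i s / η := (one_le_div hη).2 h3
    linarith
  simp [bump, h4]

theorem norm_sub_saddle_ge {i j : Fin 3} (hij : j ≠ i) (h : ‖s - saddle i‖ ≤ ‖s - saddle j‖) :
    1 / 8 ≤ ‖s - saddle j‖ := by
  have h1 := abs_sub_saddle_le s i i
  have h2 := abs_sub_saddle_le s j i
  have e1 : saddle i i = 1 / 2 := by simp [saddle]
  have e2 : saddle j i = 1 / 4 := by simp [saddle, hij.symm]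
  rw [e1] at h1
  rw [e2] at h2
  rw [abs_le] at h1 h2
  linarith

/-- Each bump lives within `1/16` of its saddle, and a point closest to saddle `i` is at least `1/8`
from the others, so a move of at most `1/16` never meets another bump. -/
theorem sum_bump_eq (hε : 0 < ε) (hη : 0 < η) (hηε : η ≤ ε / 256)
    (hi : ∀ j, ‖s - saddle i‖ ≤ ‖s - saddle j‖) {t : Fin 3 → ℝ} (ht : ‖t - s‖ ≤ 1 / 16) :
    ∑ j, bump ε η j t = bump ε η i t := by
  refine Finset.sum_eq_single i (fun j _ hj => bump_eq_zero hε hη hηε ?_) (by simp)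
  have h1 := norm_sub_saddle_ge hj (hi j)
  have h2 : ‖s - saddle j‖ ≤ ‖t - s‖ + ‖t - saddle j‖ := by
    rw [← norm_sub_rev s t]
    exact norm_sub_le_norm_sub_add_norm_sub s t (saddle j)
  linarith

theorem ellDist_add (δ : ℝ) (v : Fin 3 → ℝ) : ellDist ε i (s + δ • v) - ellDist ε i s =
    δ * (2 * (s i - saddle i i) * v i + ε * (2 * ∑ k, (s k - saddle i k) * v k)) +
      δ ^ 2 * (v i ^ 2 + ε * ∑ k, v k ^ 2) := by
  simp only [ellDist, Fin.sum_univ_three, Pi.add_apply, Pi.smul_apply, smul_eq_mul]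
  ring

theorem abs_ellDist_add_le (hε : 0 ≤ ε) (hε1 : ε ≤ 1) {δ : ℝ} (hδ : 0 ≤ δ) {v : Fin 3 → ℝ}
    (hv : ∀ k, |v k| ≤ 1) : |ellDist ε i (s + δ • v) - ellDist ε i s| ≤
      8 * δ * ‖s - saddle i‖ + 4 * δ ^ 2 := by
  rw [ellDist_add]
  set d := ‖s - saddle i‖ with hd
  have hd0 : 0 ≤ d := norm_nonneg _
  have h1 := abs_sum_mul_le (x := fun k => s k - saddle i k) (y := v) (abs_sub_saddle_le s i) hv
  have h2 := sum_sq_le hv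
  have h3 : 0 ≤ ∑ k, v k ^ 2 := Finset.sum_nonneg fun _ _ => sq_nonneg _
  have h4 : |(s i - saddle i i) * v i| ≤ d := by
    rw [abs_mul]
    have := abs_sub_saddle_le s i i
    nlinarith [abs_nonneg (s i - saddle i i), abs_nonneg (v i), hv i]
  have h5 : v i ^ 2 ≤ 1 := by
    rw [← sq_abs]; have := abs_nonneg (v i); nlinarith [hv i]
  rw [← hd] at h1
  rw [abs_le] at h1 h4
  set Q := ∑ k, (s k - saddle i k) * v k
  set R := ∑ k, v k ^ 2
  have hQ : ε * Q ≤ 3 * d ∧ -(3 * d) ≤ ε * Q := by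
    constructor <;> nlinarith
  have hR : ε * R ≤ 3 ∧ 0 ≤ ε * R := by
    constructor
    · nlinarith
    · positivity
  have b1 : 2 * (s i - saddle i i) * v i + ε * (2 * Q) ≤ 8 * d := by linarith
  have b2 : -(8 * d) ≤ 2 * (s i - saddle i i) * v i + ε * (2 * Q) := by linarith
  have b3 : v i ^ 2 + ε * R ≤ 4 := by linarith
  have b4 : 0 ≤ v i ^ 2 + ε * R := by nlinarith [sq_nonneg (v i)]
  rw [abs_le]
  have hδ2 := sq_nonneg δ
  constructor <;> nlinarith [mul_le_mul_of_nonneg_left b1 hδ, mul_le_mul_of_nonneg_left b2 hδ,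
    mul_le_mul_of_nonneg_left b3 hδ2, mul_nonneg hδ2 b4]

/-- The variance pushes the squared distance up by `δ² / 48`. Against it stand the drift in the
unstable direction (`κ`), the drift in the `ε`-weighted sum, and the error `L δ` of the mean. -/
theorem ellDist_step_mean {L δ D κ : ℝ} {ι : Type} [Fintype ι] {w : ι → ℝ}
    {v : ι → Fin 3 → ℝ} (hL : 0 < L) (hδ : 0 < δ) (hε : 0 ≤ ε) (hε1 : ε ≤ 1)
    (h : IsStep L δ s w v) (hx : -(κ * ‖s - saddle i‖ ^ 2) ≤ (s i - saddle i i) * drift s i)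
    (hdrift : ∀ k, |drift s k| ≤ D * ‖s - saddle i‖) :
    -(δ * (2 * κ + 6 * ε * D) * ‖s - saddle i‖ ^ 2) - 8 * L * δ ^ 2 * ‖s - saddle i‖ + δ ^ 2 / 48 ≤
      wmean w fun j => ellDist ε i (s + δ • v j) - ellDist ε i s := by
  set d := ‖s - saddle i‖ with hd
  have hd0 : 0 ≤ d := norm_nonneg _
  have h1 : ∀ j, (2 * δ * (s i - saddle i i)) * v j i +
      ((2 * δ * ε * (s 0 - saddle i 0)) * v j 0 + ((2 * δ * ε * (s 1 - saddle i 1)) * v j 1 +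
      ((2 * δ * ε * (s 2 - saddle i 2)) * v j 2 + δ ^ 2 * v j i ^ 2))) ≤
      ellDist ε i (s + δ • v j) - ellDist ε i s := by
    intro j
    rw [ellDist_add]
    have : 0 ≤ δ ^ 2 * (ε * ∑ k, v j k ^ 2) := by positivity
    simp only [Fin.sum_univ_three] at this ⊢
    linarith
  refine le_trans ?_ (wmean_mono h.nonneg h1)
  simp only [wmean_add, wmean_mul]
  have m1 := abs_le.1 (abs_sum_mul_le (x := fun k => s k - saddle i k)
    (y := fun k => wmean w (fun i => v i k) - drift s k) (abs_sub_saddle_le s i) h.mean)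
  have m2 := abs_le.1 (abs_sum_mul_le (x := fun k => s k - saddle i k)
    (y := drift s) (abs_sub_saddle_le s i) hdrift)
  have m3 : |(s i - saddle i i) * (wmean w (fun j => v j i) - drift s i)| ≤ d * (L * δ) := by
    rw [abs_mul]
    exact mul_le_mul (abs_sub_saddle_le s i i) (h.mean i) (abs_nonneg _) hd0
  rw [abs_le] at m3
  have m4 := mul_le_mul_of_nonneg_left (h.var i) (sq_nonneg δ)
  rw [← hd] at m1 m2
  have hLδ : 0 ≤ d * (L * δ) := by positivity
  have n1 := mul_le_mul_of_nonneg_left m1.1 (by positivity : 0 ≤ 2 * δ * ε)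
  have n2 := mul_le_mul_of_nonneg_left m2.1 (by positivity : 0 ≤ 2 * δ * ε)
  have n3 := mul_le_mul_of_nonneg_left m3.1 (by positivity : 0 ≤ 2 * δ)
  have n4 := mul_le_mul_of_nonneg_left hx (by positivity : 0 ≤ 2 * δ)
  have n5 : 2 * δ * ε * (3 * (d * (L * δ))) ≤ 2 * δ * (3 * (d * (L * δ))) := by
    have : 0 ≤ 2 * δ * (3 * (d * (L * δ))) := by positivity
    nlinarith
  simp only [Fin.sum_univ_three] at n1 n2
  linarith

end Bump

/-! ### The potential corrected by bumps. -/

/-- Near a saddle, the unstable coordinate does not contract, up to second order errors. -/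
theorem exists_unstable_radius {κ : ℝ} (hκ : 0 < κ) : ∃ r > 0, ∀ (i : Fin 3) (s : Fin 3 → ℝ),
    ∑ k, s k = 1 → ‖s - saddle i‖ ≤ r →
      -(κ * ‖s - saddle i‖ ^ 2) ≤ (s i - saddle i i) * drift s i := by
  choose r hr h using fun i => drift_near_saddle i hκ
  refine ⟨min (r 0) (min (r 1) (r 2)), by simp [hr], fun i s hs hsr => ?_⟩
  have hi : ‖s - saddle i‖ ≤ r i := by
    simp only [le_min_iff] at hsr
    fin_cases i
    · exact hsr.1
    · exact hsr.2.1
    · exact hsr.2.2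
  have h1 := (h i s hs hi).1
  set x := s i - saddle i i with hx
  set d := ‖s - saddle i‖ with hd
  have hxd : |x| ≤ d := abs_sub_saddle_le s i i
  have h2 : |x * (drift s i - (3 / 8 * slope - 1) * x)| ≤ d * (κ * d) := by
    rw [abs_mul]
    exact mul_le_mul hxd h1 (abs_nonneg _) (norm_nonneg _)
  have h3 := (abs_le.1 h2).1
  have := slope_bounds.1
  nlinarith [mul_nonneg (by linarith : 0 ≤ 3 / 8 * slope - 1) (sq_nonneg x)]

theorem exists_pos_mul_le {a b : ℝ} (ha : 0 ≤ a) (hb : 0 < b) :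
    ∃ c > 0, c ≤ 1 ∧ ∀ x, 0 ≤ x → x ≤ c → a * x ≤ b := by
  refine ⟨min 1 (b / (a + 1)), by positivity, min_le_left _ _, fun x hx0 hx => ?_⟩
  have h1 : x ≤ b / (a + 1) := hx.trans (min_le_right _ _)
  rw [le_div_iff₀ (by positivity)] at h1
  linarith

/-- The potential plus bumps at the saddles. -/
def profile (C ε η : ℝ) (s : Fin 3 → ℝ) : ℝ := potential s + C * ∑ j, bump ε η j s

section Profile

variable {C ε η D : ℝ} {i : Fin 3} {s : Fin 3 → ℝ}

theorem abs_bump_sub_le (hε : 0 < ε) (hε1 : ε ≤ 1) (hη : 0 < η) :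
    |bump ε η i s - η / 2| ≤ 4 * ‖s - saddle i‖ ^ 2 := by
  obtain ⟨h0, h1⟩ := height_mem (i := i) (s := s) hε.le hη
  have h4 : 1 - ellDist ε i s / η ≤ height ε η i s := le_max_right _ _
  have h6 := ellDist_upper (s := s) (i := i) hε.le hε1
  have h7 : η * (ellDist ε i s / η) = ellDist ε i s := by field_simp
  have h8 : η * (1 - height ε η i s) ≤ ellDist ε i s := by
    rw [← h7]; exact mul_le_mul_of_nonneg_left (by linarith) hη.le
  unfold bump
  rw [abs_le]
  constructor
  · nlinarith [mul_nonneg hη.le (sq_nonneg (1 - height ε η i s))]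
  · have h9 : η * height ε η i s ^ 2 ≤ η * 1 :=
      mul_le_mul_of_nonneg_left (by nlinarith) hη.le
    nlinarith [sq_nonneg ‖s - saddle i‖]

/-- The drift vanishes at the saddle, so the potential deviates only quadratically there; it has the
same value at all three saddles, so one reference level serves them all. -/
theorem abs_profile_sub_le (hC : 0 < C) (hε : 0 < ε) (hε1 : ε ≤ 1) (hη : 0 < η)
    (hηε : η ≤ ε / 256) (hD : 0 < D) (hlip : ∀ s ∈ stdSimplex ℝ (Fin 3),
      ∀ t ∈ stdSimplex ℝ (Fin 3), ∀ k, |drift s k - drift t k| ≤ D * ‖s - t‖)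
    (hs : s ∈ stdSimplex ℝ (Fin 3)) (hi : ∀ j, ‖s - saddle i‖ ≤ ‖s - saddle j‖) :
    |profile C ε η s - (potential (saddle 0) + C * (η / 2))| ≤
      (slope * (3 * D + 3 / 2) + 4 * C) * ‖s - saddle i‖ ^ 2 := by
  have h1 := potential_sub_abs_le hD hlip (saddle_mem i) hs (b := 0)
    (fun k => by rw [drift_saddle, abs_zero]) le_rfl
  rw [potential_saddle i] at h1
  have h2 : ∑ j, bump ε η j s = bump ε η i s :=
    sum_bump_eq hε hη hηε hi (by rw [sub_self, norm_zero]; norm_num)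
  have h5 := mul_le_mul_of_nonneg_left (abs_bump_sub_le (i := i) (s := s) hε hε1 hη) hC.le
  have e : profile C ε η s - (potential (saddle 0) + C * (η / 2)) =
      (potential s - potential (saddle 0)) + C * (bump ε η i s - η / 2) := by
    rw [profile, h2]; ring
  rw [e]
  refine (abs_add_le _ _).trans ?_
  rw [abs_mul, abs_of_pos hC]
  linarith

variable {L δ κ r : ℝ} {ι : Type} [Fintype ι] {w : ι → ℝ} {v : ι → Fin 3 → ℝ}

theorem IsStep.norm_incr_le (hδ : 0 < δ) (h : IsStep L δ s w v) (j : ι) :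
    ‖s + δ • v j - s‖ ≤ δ := by
  rw [add_sub_cancel_left, pi_norm_le_iff_of_nonneg hδ.le]
  intro k
  rw [Pi.smul_apply, smul_eq_mul, Real.norm_eq_abs, abs_mul, abs_of_pos hδ]
  have := h.bound j k
  nlinarith

theorem profile_step_eq (hε : 0 < ε) (hη : 0 < η) (hηε : η ≤ ε / 256) (hδ : 0 < δ)
    (hδ1 : δ ≤ 1 / 16) (h : IsStep L δ s w v) (hi : ∀ j, ‖s - saddle i‖ ≤ ‖s - saddle j‖) (j : ι) :
    profile C ε η (s + δ • v j) - profile C ε η s = (potential (s + δ • v j) - potential s) +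
      C * (bump ε η i (s + δ • v j) - bump ε η i s) := by
  simp only [profile]
  rw [sum_bump_eq hε hη hηε hi ((h.norm_incr_le hδ j).trans hδ1),
    sum_bump_eq hε hη hηε hi (by rw [sub_self, norm_zero]; norm_num)]
  ring

theorem ellDist_step_sq_le (hε : 0 < ε) (hε1 : ε ≤ 1) (hδ : 0 < δ) (h : IsStep L δ s w v) (j : ι) :
    (ellDist ε i (s + δ • v j) - ellDist ε i s) ^ 2 ≤
      (8 * δ * ‖s - saddle i‖ + 4 * δ ^ 2) ^ 2 := by
  rw [← sq_abs]
  exact pow_le_pow_left₀ (abs_nonneg _) (abs_ellDist_add_le hε.le hε1 hδ.le (h.bound j)) 2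

/-- A rise of `ellDist` lowers the bump at rate `height`, which yields the gain `-δ² / 48`; the last
term is the second order error of the bump. -/
theorem bump_step_mean (hε : 0 < ε) (hε1 : ε ≤ 1) (hη : 0 < η) (hηr : η ≤ ε * r ^ 2) (hr : 0 < r)
    (hκ : 0 < κ) (hD : 0 < D) (hL : 0 < L) (hδ : 0 < δ) (h : IsStep L δ s w v)
    (hunst : ‖s - saddle i‖ ≤ r →
      -(κ * ‖s - saddle i‖ ^ 2) ≤ (s i - saddle i i) * drift s i)
    (hdrift : ∀ k, |drift s k| ≤ D * ‖s - saddle i‖) :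
    wmean w (fun j => bump ε η i (s + δ • v j) - bump ε η i s) ≤
      δ * (2 * κ + 6 * ε * D) * ‖s - saddle i‖ ^ 2 +
        height ε η i s * (8 * L * δ ^ 2 * ‖s - saddle i‖ - δ ^ 2 / 48) +
        (64 * δ ^ 2 * ‖s - saddle i‖ ^ 2 + 16 * δ ^ 4) / η := by
  obtain ⟨ha0, ha1⟩ := height_mem (i := i) (s := s) hε.le hη
  have hd0 : 0 ≤ ‖s - saddle i‖ := norm_nonneg _
  have hell := ellDist_step_mean (s := s) (i := i) (κ := κ) (D := D) hL hδ hε.le hε1 h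
  have hlow := ellDist_lower (s := s) (i := i) hε.le
  have hq2 := ellDist_step_sq_le (i := i) hε hε1 hδ h
  have hbump := fun j => (bump_sub_bounds (ε := ε) (i := i) (s := s) hη (s + δ • v j)).2
  -- The expansion at the saddle is available only within `r`; where the height is positive, `η ≤ ε
  -- * r ^ 2` guarantees this.
  have hmax : 0 < height ε η i s → ellDist ε i s < η := by
    intro h0
    by_contra! hcon
    refine h0.ne' (max_eq_left ?_)
    have := (one_le_div hη).2 hcon
    linarith
  generalize height ε η i s = a at *
  generalize ‖s - saddle i‖ = d at *
  have h2 : wmean w (fun j => bump ε η i (s + δ • v j) - bump ε η i s) ≤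
      -a * wmean w (fun j => ellDist ε i (s + δ • v j) - ellDist ε i s) +
        (8 * δ * d + 4 * δ ^ 2) ^ 2 / (2 * η) := by
    refine (wmean_mono h.nonneg (g := fun j => -a * (ellDist ε i (s + δ • v j) -
      ellDist ε i s) + (8 * δ * d + 4 * δ ^ 2) ^ 2 / (2 * η)) fun j => ?_).trans_eq ?_
    · have h4 : (ellDist ε i (s + δ • v j) - ellDist ε i s) ^ 2 / (2 * η) ≤
          (8 * δ * d + 4 * δ ^ 2) ^ 2 / (2 * η) := by gcongr ?_ / _; exact hq2 j
      linarith [hbump j]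
    · rw [wmean_add, wmean_mul, wmean_const h.sum_one]
  have h3 : -a * wmean w (fun j => ellDist ε i (s + δ • v j) - ellDist ε i s) ≤
      δ * (2 * κ + 6 * ε * D) * d ^ 2 + a * (8 * L * δ ^ 2 * d - δ ^ 2 / 48) := by
    have hpos : 0 ≤ δ * (2 * κ + 6 * ε * D) * d ^ 2 := by positivity
    rcases ha0.eq_or_lt with h0 | h0
    · rw [← h0]; simpa using hpos
    · have hdr : d ≤ r := by
        have h5 : ε * d ^ 2 ≤ ε * r ^ 2 := by linarith [hmax h0]
        exact (sq_le_sq₀ hd0 hr.le).1 (le_of_mul_le_mul_left h5 hε)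
      have h8 := mul_le_mul_of_nonneg_left (hell (hunst hdr) hdrift) ha0
      have h9 := mul_le_mul_of_nonneg_right ha1 hpos
      linarith
  have h4 : (8 * δ * d + 4 * δ ^ 2) ^ 2 / (2 * η) ≤ (64 * δ ^ 2 * d ^ 2 + 16 * δ ^ 4) / η := by
    rw [div_le_div_iff₀ (by positivity) hη]
    have : (8 * δ * d + 4 * δ ^ 2) ^ 2 ≤ 2 * (64 * δ ^ 2 * d ^ 2 + 16 * δ ^ 4) := by
      linarith [sq_nonneg (8 * δ * d - 4 * δ ^ 2)]
    linarith [mul_le_mul_of_nonneg_right this hη.le]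
  linarith

/-- The mean increment of the profile within distance `r₁` of a saddle. -/
theorem mean_bound_near {X δ n d a A C₂ η δ₀ r₁ : ℝ} (hδ : 0 < δ) (hδδ : δ ≤ δ₀) (hd0 : 0 ≤ d)
    (hd1 : d ≤ 1) (hη : 0 < η) (hC₂ : 0 < C₂) (ha : 1 / 2 ≤ a) (hdr : d ≤ r₁) (hL : 0 < L)
    (hr₁a : 8 * L * r₁ ≤ 1 / 96) (hr₁c : 384 * C₂ * 64 / η * r₁ ≤ C₂ / 4)
    (hδ₀ : 384 * C₂ * 16 / η * δ₀ ≤ C₂ / 4) (hδ₀1 : δ ≤ 1 / 16)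
    (hX : X ≤ -(A * (δ * n)) + C₂ * δ ^ 2 +
      384 * C₂ * (a * (8 * L * δ ^ 2 * d - δ ^ 2 / 48)) +
      384 * C₂ * ((64 * δ ^ 2 * d ^ 2 + 16 * δ ^ 4) / η)) :
    X ≤ -(A * (δ * n)) - C₂ / 2 * δ ^ 2 := by
  have hδ2 := sq_nonneg δ
  -- Half of `1/48` pays for the error in `L`, and the height is at least `1/2`. Multiplied by `384
  -- * C₂` this gives `-2 * C₂ * δ ^ 2`, twice the error of the potential.
  have k1 : a * (8 * L * δ ^ 2 * d - δ ^ 2 / 48) ≤ -(δ ^ 2 / 192) := by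
    have h6 : 8 * L * d ≤ 8 * L * r₁ := by gcongr
    have h7 := mul_le_mul_of_nonneg_right (h6.trans hr₁a) hδ2
    have h8 := mul_le_mul_of_nonneg_right ha hδ2
    have h9 : a * (8 * L * δ ^ 2 * d - δ ^ 2 / 48) ≤ a * (-(δ ^ 2 / 96)) :=
      mul_le_mul_of_nonneg_left (by linarith) (by linarith)
    linarith
  have k2 : 384 * C₂ * ((64 * δ ^ 2 * d ^ 2 + 16 * δ ^ 4) / η) ≤ C₂ / 2 * δ ^ 2 := by
    have hdd : d ^ 2 ≤ r₁ := by nlinarith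
    have hδ4 : δ ^ 2 ≤ δ₀ := by nlinarith
    have e : 384 * C₂ * ((64 * δ ^ 2 * d ^ 2 + 16 * δ ^ 4) / η) =
        (384 * C₂ * 64 / η * d ^ 2 + 384 * C₂ * 16 / η * δ ^ 2) * δ ^ 2 := by ring
    rw [e]
    have h7 : 384 * C₂ * 64 / η * d ^ 2 ≤ 384 * C₂ * 64 / η * r₁ := by gcongr
    have h8 : 384 * C₂ * 16 / η * δ ^ 2 ≤ 384 * C₂ * 16 / η * δ₀ := by gcongr
    have h9 := mul_le_mul_of_nonneg_right (add_le_add (h7.trans hr₁c) (h8.trans hδ₀)) hδ2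
    linarith
  have k3 := mul_le_mul_of_nonneg_left k1 hC₂.le
  linarith

/-- The mean increment of the profile where the drift is bounded below. -/
theorem mean_bound_far {X δ n d a A C₂ η δ₀ N : ℝ} (hδ : 0 < δ) (hδδ : δ ≤ δ₀) (hd0 : 0 ≤ d)
    (hd1 : d ≤ 1) (hη : 0 < η) (hC₂ : 0 < C₂) (ha0 : 0 ≤ a) (ha1 : a ≤ 1) (hL : 0 < L)
    (hδ₀1 : δ ≤ 1 / 16) (hA : 0 < A) (hN : N ≤ n)
    (hδ₀ : (2 * C₂ + 384 * C₂ * (8 * L + 80 / η)) * δ₀ ≤ A * N / 2)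
    (hX : X ≤ -(A * (δ * n)) + C₂ * δ ^ 2 +
      384 * C₂ * (a * (8 * L * δ ^ 2 * d - δ ^ 2 / 48)) +
      384 * C₂ * ((64 * δ ^ 2 * d ^ 2 + 16 * δ ^ 4) / η)) :
    X ≤ -(A / 2 * (δ * n)) - C₂ * δ ^ 2 := by
  have hδ2 := sq_nonneg δ
  have k1 : a * (8 * L * δ ^ 2 * d - δ ^ 2 / 48) ≤ 8 * L * δ ^ 2 := by
    have h7 : 8 * L * δ ^ 2 * d ≤ 8 * L * δ ^ 2 * 1 := by gcongr
    have h8 : a * (8 * L * δ ^ 2 * d - δ ^ 2 / 48) ≤ a * (8 * L * δ ^ 2) :=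
      mul_le_mul_of_nonneg_left (by linarith) ha0
    have h9 : a * (8 * L * δ ^ 2) ≤ 1 * (8 * L * δ ^ 2) := by gcongr
    linarith
  have k2 : (64 * δ ^ 2 * d ^ 2 + 16 * δ ^ 4) / η ≤ 80 / η * δ ^ 2 := by
    have e : (64 * δ ^ 2 * d ^ 2 + 16 * δ ^ 4) / η = (64 / η * d ^ 2 + 16 / η * δ ^ 2) * δ ^ 2 := by
      ring
    rw [e]
    refine mul_le_mul_of_nonneg_right ?_ hδ2
    have h1 : 64 / η * d ^ 2 ≤ 64 / η * 1 := by gcongr; nlinarith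
    have h2 : 16 / η * δ ^ 2 ≤ 16 / η * 1 := by gcongr; nlinarith
    have h3 : 64 / η * 1 + 16 / η * 1 = 80 / η := by ring
    linarith
  have k3 := mul_le_mul_of_nonneg_left k1 hC₂.le
  have k4 := mul_le_mul_of_nonneg_left k2 hC₂.le
  have k5 : (2 * C₂ + 384 * C₂ * (8 * L + 80 / η)) * δ ≤ A * n / 2 := by
    have h6 : (2 * C₂ + 384 * C₂ * (8 * L + 80 / η)) * δ ≤
      (2 * C₂ + 384 * C₂ * (8 * L + 80 / η)) * δ₀ := by gcongr
    have h7 := mul_le_mul_of_nonneg_left hN hA.le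
    linarith
  have k6 := mul_le_mul_of_nonneg_right k5 hδ.le
  linarith

theorem bump_step_abs_le (hε : 0 < ε) (hε1 : ε ≤ 1) (hη : 0 < η) (hδ : 0 < δ) (hδ1 : δ ≤ 1 / 16)
    (hd1 : ‖s - saddle i‖ ≤ 1) (h : IsStep L δ s w v) (j : ι) :
    |bump ε η i (s + δ • v j) - bump ε η i s| ≤
      (1 + 6 / η) * (8 * δ * ‖s - saddle i‖ + 4 * δ ^ 2) := by
  obtain ⟨ha0, ha1⟩ := height_mem (i := i) (s := s) hε.le hη
  have h2 := bump_sub_bounds (ε := ε) (i := i) (s := s) hη (s + δ • v j)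
  have h3 := abs_ellDist_add_le (i := i) (s := s) hε.le hε1 hδ.le (h.bound j)
  have h4 := ellDist_step_sq_le (i := i) hε hε1 hδ h j
  have hd0 : 0 ≤ ‖s - saddle i‖ := norm_nonneg _
  have hF12 : 8 * δ * ‖s - saddle i‖ + 4 * δ ^ 2 ≤ 12 := by nlinarith
  have hF0 : 0 ≤ 8 * δ * ‖s - saddle i‖ + 4 * δ ^ 2 := by positivity
  generalize height ε η i s = a at *
  generalize ellDist ε i (s + δ • v j) - ellDist ε i s = Δ at *
  generalize 8 * δ * ‖s - saddle i‖ + 4 * δ ^ 2 = F at *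
  have haΔ : |a * Δ| ≤ F := by
    rw [abs_mul, abs_of_nonneg ha0]
    nlinarith [abs_nonneg Δ]
  have hΔ2 : Δ ^ 2 / (2 * η) ≤ 6 / η * F := by
    rw [div_le_iff₀ (by positivity)]
    have : 6 / η * F * (2 * η) = 12 * F := by field_simp; ring
    nlinarith
  have h0 : 0 ≤ 6 / η * F := by positivity
  rw [abs_le] at haΔ ⊢
  constructor <;> linarith

/-- The distance to the saddle is traded for the size of the drift by `hni`, so that steps are small
wherever the mean decrease is small. -/
theorem profile_step_abs_le {c₀ : ℝ} (hC : 0 < C) (hε : 0 < ε) (hε1 : ε ≤ 1) (hη : 0 < η)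
    (hηε : η ≤ ε / 256) (hD : 0 < D) (hlip : ∀ s ∈ stdSimplex ℝ (Fin 3),
      ∀ t ∈ stdSimplex ℝ (Fin 3), ∀ k, |drift s k - drift t k| ≤ D * ‖s - t‖)
    (hδ : 0 < δ) (hδ1 : δ ≤ 1 / 16) (h : IsStep L δ s w v)
    (hi : ∀ j, ‖s - saddle i‖ ≤ ‖s - saddle j‖) (hc₀ : 0 < c₀)
    (hni : c₀ * ‖s - saddle i‖ ^ 2 ≤ driftSq s) (j : ι) :
    |profile C ε η (s + δ • v j) - profile C ε η s| ≤
      (slope * (3 + (3 * D + 3 / 2)) + C * ((1 + 6 / η) * (8 / √c₀ + 4))) *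
        (δ * √(driftSq s) + δ ^ 2) := by
  have hsc : 0 < √c₀ := Real.sqrt_pos.2 hc₀
  have hd0 : 0 ≤ ‖s - saddle i‖ := norm_nonneg _
  have h1 := potential_sub_abs_le hD hlip h.mem (h.mem_add j) (abs_drift_le_sqrt s)
    (h.norm_incr_le hδ j)
  have h2 := bump_step_abs_le (i := i) hε hε1 hη hδ hδ1 (norm_sub_saddle_le h.mem i) h j
  rw [profile_step_eq hε hη hηε hδ hδ1 h hi]
  have hsn : ‖s - saddle i‖ ≤ √(driftSq s) / √c₀ := by
    rw [le_div_iff₀ hsc, ← Real.sqrt_sq hd0, ← Real.sqrt_mul (sq_nonneg _)]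
    exact Real.sqrt_le_sqrt (by linarith)
  have hn0 : 0 ≤ √(driftSq s) := Real.sqrt_nonneg _
  generalize ‖s - saddle i‖ = d at *
  generalize √(driftSq s) = n at *
  have hδs : 0 ≤ δ * n := by positivity
  have hFR : 8 * δ * d + 4 * δ ^ 2 ≤ (8 / √c₀ + 4) * (δ * n + δ ^ 2) := by
    have e1 : 8 * δ * d ≤ 8 / √c₀ * (δ * n) := by
      calc 8 * δ * d ≤ 8 * δ * (n / √c₀) := by gcongr
        _ = _ := by ring
    have e2 : 0 ≤ 8 / √c₀ * δ ^ 2 := by positivity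
    linarith
  refine (abs_add_le _ _).trans ?_
  rw [abs_mul, abs_of_pos hC]
  have g1 : slope * (3 * n * δ + (3 * D + 3 / 2) * δ ^ 2) ≤
      slope * ((3 + (3 * D + 3 / 2)) * (δ * n + δ ^ 2)) := by
    refine mul_le_mul_of_nonneg_left ?_ slope_pos.le
    have := mul_nonneg hD.le hδs
    linarith [sq_nonneg δ]
  have g2 : C * ((1 + 6 / η) * (8 * δ * d + 4 * δ ^ 2)) ≤
      C * ((1 + 6 / η) * ((8 / √c₀ + 4) * (δ * n + δ ^ 2))) := by gcongr
  have g3 := mul_le_mul_of_nonneg_left h2 hC.le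
  linarith

theorem profile_step_mean (hC : 0 < C) (hε : 0 < ε) (hε1 : ε ≤ 1) (hη : 0 < η)
    (hηε : η ≤ ε / 256) (hηr : η ≤ ε * r ^ 2) (hr : 0 < r) (hκ : 0 < κ) (hD : 0 < D) (hL : 0 < L)
    (hδ : 0 < δ) (hδ1 : δ ≤ 1 / 16) (h : IsStep L δ s w v)
    (hi : ∀ j, ‖s - saddle i‖ ≤ ‖s - saddle j‖)
    (hunst : ‖s - saddle i‖ ≤ r →
      -(κ * ‖s - saddle i‖ ^ 2) ≤ (s i - saddle i i) * drift s i)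
    (hdrift : ∀ k, |drift s k| ≤ D * ‖s - saddle i‖)
    (hsmall : C * (2 * κ + 6 * ε * D) * ‖s - saddle i‖ ^ 2 ≤ slope / 2 * driftSq s) :
    wmean w (fun j => profile C ε η (s + δ • v j) - profile C ε η s) ≤
      -(slope / 2 * (δ * driftSq s)) + slope * (3 * L + 3 / 2) * δ ^ 2 +
        C * (height ε η i s * (8 * L * δ ^ 2 * ‖s - saddle i‖ - δ ^ 2 / 48)) +
        C * ((64 * δ ^ 2 * ‖s - saddle i‖ ^ 2 + 16 * δ ^ 4) / η) := by
  simp only [profile_step_eq hε hη hηε hδ hδ1 h hi]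
  rw [wmean_add, wmean_mul]
  have h1 := potential_step_mean hδ h
  have h2 := mul_le_mul_of_nonneg_left (bump_step_mean hε hε1 hη hηr hr hκ hD hL hδ h hunst hdrift)
    hC.le
  have h3 := mul_le_mul_of_nonneg_left hsmall hδ.le
  linarith

end Profile

/-- There is a function with negative mean increments outside the central region. -/
theorem exists_lyapunov_profile {L : ℝ} (hL : 0 < L) :
    ∃ (h : (Fin 3 → ℝ) → ℝ) (u₀ B c δ₀ : ℝ), 0 < B ∧ 0 < c ∧ 0 < δ₀ ∧
      (∀ s ∈ stdSimplex ℝ (Fin 3), |h s - u₀| ≤ B) ∧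
      ∀ (δ : ℝ) (s : Fin 3 → ℝ) (ι : Type) [Fintype ι] (w : ι → ℝ) (v : ι → Fin 3 → ℝ),
        0 < δ → δ ≤ δ₀ → IsStep L δ s w v → rho / 2 ≤ centreDist s →
        wmean w (fun j => h (s + δ • v j) - h s) ≤ -(c * (δ * driftSq s + δ ^ 2)) ∧
        (∀ j, |h (s + δ • v j) - h s| ≤ B * (δ * √(driftSq s) + δ ^ 2)) ∧
        |h s - u₀| ≤ B * driftSq s := by
  obtain ⟨c₀, hc₀, hlow⟩ := exists_driftSq_lower
  obtain ⟨D, hD, hlip⟩ := exists_drift_lipschitz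
  have ha := slope_pos
  have hdrift : ∀ s ∈ stdSimplex ℝ (Fin 3), ∀ i k, |drift s k| ≤ D * ‖s - saddle i‖ := by
    intro s hs i k
    have := hlip s hs _ (saddle_mem i) k
    rwa [drift_saddle, sub_zero] at this
  -- The order of choices matters: the bump coefficient `384 * C₂` depends only on `L`. Then `κ` and
  -- `ε` are taken so small that the drift on the bump costs at most half the gain of the potential,
  -- then `r` from `κ`, the bump size `η`, the inner radius `r₁`, and finally `δ₀`.
  obtain ⟨C₂, hC₂, hC₂e⟩ : ∃ C₂ > 0, slope * (3 * L + 3 / 2) = C₂ := ⟨_, by positivity, rfl⟩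
  have hC₁ : 0 < 384 * C₂ := by positivity
  obtain ⟨κ, hκ, -, hκ'⟩ := exists_pos_mul_le (a := 384 * C₂ * 2) (b := slope * c₀ / 4)
    (by positivity) (by positivity)
  obtain ⟨ε, hε, hε1, hε'⟩ := exists_pos_mul_le (a := 384 * C₂ * 6 * D) (b := slope * c₀ / 4)
    (by positivity) (by positivity)
  replace hκ' := hκ' κ hκ.le le_rfl
  replace hε' := hε' ε hε.le le_rfl
  obtain ⟨r, hr, hunst⟩ := exists_unstable_radius hκ
  obtain ⟨η, hη, hηε, hηr⟩ : ∃ η > 0, η ≤ ε / 256 ∧ η ≤ ε * r ^ 2 :=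
    ⟨min (ε / 256) (ε * r ^ 2), by positivity, min_le_left _ _, min_le_right _ _⟩
  obtain ⟨r₁, hr₁, hr₁a, hr₁b, hr₁c⟩ : ∃ r₁ > 0, 8 * L * r₁ ≤ 1 / 96 ∧
      8 * r₁ ≤ η ∧ 384 * C₂ * 64 / η * r₁ ≤ C₂ / 4 := by
    obtain ⟨x, hx, -, hx'⟩ := exists_pos_mul_le (a := 8 * L) (b := 1 / 96)
      (by positivity) (by positivity)
    obtain ⟨y, hy, -, hy'⟩ := exists_pos_mul_le (a := 8) (b := η) (by positivity) hη
    obtain ⟨z, hz, -, hz'⟩ := exists_pos_mul_le (a := 384 * C₂ * 64 / η) (b := C₂ / 4)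
      (by positivity) (by positivity)
    have h0 : 0 < min x (min y z) := by positivity
    exact ⟨min x (min y z), h0, hx' _ h0.le (min_le_left _ _),
      hy' _ h0.le ((min_le_right _ _).trans (min_le_left _ _)),
      hz' _ h0.le ((min_le_right _ _).trans (min_le_right _ _))⟩
  obtain ⟨δ₀, hδ₀, hδ₀1, hδ₀a, hδ₀b⟩ : ∃ δ₀ > 0, δ₀ ≤ 1 / 16 ∧
      384 * C₂ * 16 / η * δ₀ ≤ C₂ / 4 ∧
      (2 * C₂ + 384 * C₂ * (8 * L + 80 / η)) * δ₀ ≤ slope / 2 * (c₀ * r₁ ^ 2) / 2 := by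
    obtain ⟨x, hx, -, hx'⟩ := exists_pos_mul_le (a := 384 * C₂ * 16 / η) (b := C₂ / 4)
      (by positivity) (by positivity)
    obtain ⟨y, hy, -, hy'⟩ := exists_pos_mul_le (a := 2 * C₂ + 384 * C₂ * (8 * L + 80 / η))
      (b := slope / 2 * (c₀ * r₁ ^ 2) / 2) (by positivity) (by positivity)
    have h0 : 0 < min (1 / 16) (min x y) := by positivity
    exact ⟨min (1 / 16) (min x y), h0, min_le_left _ _,
      hx' _ h0.le ((min_le_right _ _).trans (min_le_left _ _)),
      hy' _ h0.le ((min_le_right _ _).trans (min_le_right _ _))⟩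
  obtain ⟨E, hE, hEe⟩ : ∃ E > 0, slope * (3 * D + 3 / 2) + 4 * (384 * C₂) = E :=
    ⟨_, by positivity, rfl⟩
  obtain ⟨F, hF, hFe⟩ : ∃ F > 0, slope * (3 + (3 * D + 3 / 2)) +
      384 * C₂ * ((1 + 6 / η) * (8 / √c₀ + 4)) = F := ⟨_, by positivity, rfl⟩
  have hcentre : ∀ s ∈ stdSimplex ℝ (Fin 3), ∀ i, (∀ j, ‖s - saddle i‖ ≤ ‖s - saddle j‖) →
      |profile (384 * C₂) ε η s - (potential (saddle 0) + 384 * C₂ * (η / 2))| ≤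
        E * ‖s - saddle i‖ ^ 2 := by
    intro s hs i hi
    rw [← hEe]
    exact abs_profile_sub_le hC₁ hε hε1 hη hηε hD hlip hs hi
  refine ⟨profile (384 * C₂) ε η, potential (saddle 0) + 384 * C₂ * (η / 2), E + E / c₀ + F,
    min (slope / 4) (C₂ / 2), δ₀, by positivity, by positivity, hδ₀, ?_, ?_⟩
  · intro s hs
    obtain ⟨i, hi⟩ := Finite.exists_min fun i => ‖s - saddle i‖
    have h3 : ‖s - saddle i‖ ^ 2 ≤ 1 := pow_le_one₀ (norm_nonneg _) (norm_sub_saddle_le hs i)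
    have h4 : 0 ≤ E / c₀ + F := by positivity
    have h5 := mul_le_mul_of_nonneg_left h3 hE.le
    linarith [hcentre s hs i hi]
  intro δ s ι _ w v hδ hδδ hstep hcen
  obtain ⟨i, hi, hni⟩ := hlow s hstep.mem hcen
  have hd0 : 0 ≤ ‖s - saddle i‖ := norm_nonneg _
  have hd1 := norm_sub_saddle_le hstep.mem i
  have hδ1 : δ ≤ 1 / 16 := hδδ.trans hδ₀1
  have hn0 := driftSq_nonneg s
  refine ⟨?_, fun j => ?_, ?_⟩
  · have hsmall : 384 * C₂ * (2 * κ + 6 * ε * D) * ‖s - saddle i‖ ^ 2 ≤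
        slope / 2 * driftSq s := by
      have h1 : 384 * C₂ * (2 * κ + 6 * ε * D) ≤ slope / 2 * c₀ := by linarith
      have h2 := mul_le_mul_of_nonneg_right h1 (sq_nonneg ‖s - saddle i‖)
      have h3 := mul_le_mul_of_nonneg_left hni (by positivity : 0 ≤ slope / 2)
      linarith
    have hX := profile_step_mean hC₁ hε hε1 hη hηε hηr hr hκ hD hL hδ hδ1 hstep hi
      (hunst i s hstep.mem.2) (hdrift s hstep.mem i) hsmall
    rw [hC₂e] at hX
    obtain ⟨ha0, ha1⟩ := height_mem (i := i) (s := s) hε.le hη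
    have hδn : 0 ≤ δ * driftSq s := by positivity
    have m1 := mul_le_mul_of_nonneg_right (min_le_left (slope / 4) (C₂ / 2)) hδn
    have m2 := mul_le_mul_of_nonneg_right (min_le_right (slope / 4) (C₂ / 2)) (sq_nonneg δ)
    have m3 := mul_nonneg ha.le hδn
    have m4 := mul_nonneg hC₂.le (sq_nonneg δ)
    -- Within `r₁` the bump is high and the noise supplies the `δ²` gain; beyond it the drift is
    -- bounded below and absorbs all terms of order `δ²`.
    by_cases hdr : ‖s - saddle i‖ ≤ r₁
    · have hahalf : 1 / 2 ≤ height ε η i s := by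
        have h6 := ellDist_upper (s := s) (i := i) hε.le hε1
        have h7 : ellDist ε i s / η ≤ 1 / 2 := by
          rw [div_le_iff₀ hη]
          nlinarith
        have h8 : 1 - ellDist ε i s / η ≤ height ε η i s := le_max_right _ _
        linarith
      have := mean_bound_near hδ hδδ hd0 hd1 hη hC₂ hahalf hdr hL hr₁a hr₁c hδ₀a hδ1 hX
      linarith
    · push Not at hdr
      have hN : c₀ * r₁ ^ 2 ≤ driftSq s := le_trans (by gcongr) hni
      have := mean_bound_far hδ hδδ hd0 hd1 hη hC₂ ha0 ha1 hL hδ1 (half_pos ha) hN hδ₀b hX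
      linarith
  · have h1 := profile_step_abs_le hC₁ hε hε1 hη hηε hD hlip hδ hδ1 hstep hi hc₀ hni j
    rw [hFe] at h1
    have h2 : 0 ≤ (E + E / c₀) * (δ * √(driftSq s) + δ ^ 2) := by positivity
    linarith
  · have h1 := hcentre s hstep.mem i hi
    have h2 : ‖s - saddle i‖ ^ 2 ≤ driftSq s / c₀ := by rw [le_div_iff₀ hc₀]; linarith
    have h3 := mul_le_mul_of_nonneg_left h2 hE.le
    have h4 : E * (driftSq s / c₀) = E / c₀ * driftSq s := by ring
    have h5 : 0 ≤ (E + F) * driftSq s := by positivity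
    linarith

/-! ### The `arsinh` transform and a unit drift. -/

section Arsinh

theorem sqrt_one_add_sq_le (x y : ℝ) : √(1 + y ^ 2) ≤ √(1 + x ^ 2) + |y - x| := by
  have h1 : |x| ≤ √(1 + x ^ 2) := Real.abs_le_sqrt (by linarith)
  have h2 := Real.sq_sqrt (by positivity : 0 ≤ 1 + x ^ 2)
  have h3 := abs_nonneg (y - x)
  rw [Real.sqrt_le_left (by positivity)]
  have h4 : x * (y - x) ≤ √(1 + x ^ 2) * |y - x| := by
    refine (le_abs_self _).trans ?_
    rw [abs_mul]
    exact mul_le_mul_of_nonneg_right h1 h3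
  have h5 := sq_abs (y - x)
  nlinarith

/-- Since `√(1 + y²)` is at least one and 1-Lipschitz, the derivative of `arsinh` changes over
distance `|d| ≤ 1/2` by a relative amount at most `2 |d|`. Keeping the factor `1 / √(1 + x²)` in the
error makes it comparable with the linear term. -/
theorem abs_arsinh_sub_le {x d : ℝ} (hd : |d| ≤ 1 / 2) :
    |Real.arsinh (x + d) - Real.arsinh x - d / √(1 + x ^ 2)| ≤ 2 * d ^ 2 / √(1 + x ^ 2) := by
  set W := √(1 + x ^ 2) with hW
  have hW1 : 1 ≤ W := by rw [hW, Real.one_le_sqrt]; nlinarith [sq_nonneg x]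
  have hf : ∀ y ∈ Metric.closedBall x |d|, HasDerivWithinAt (fun y => Real.arsinh y - y / W)
      ((√(1 + y ^ 2))⁻¹ - 1 / W) (Metric.closedBall x |d|) y := fun y _ =>
    ((Real.hasDerivAt_arsinh y).sub ((hasDerivAt_id y).div_const W)).hasDerivWithinAt
  have hbound : ∀ y ∈ Metric.closedBall x |d|, ‖(√(1 + y ^ 2))⁻¹ - 1 / W‖ ≤ 2 * |d| / W := by
    intro y hy
    rw [Metric.mem_closedBall, Real.dist_eq] at hy
    have h1 := sqrt_one_add_sq_le x y
    have h2 := sqrt_one_add_sq_le y x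
    rw [abs_sub_comm x y] at h2
    rw [← hW] at h1 h2
    set W' := √(1 + y ^ 2)
    have hW' : 1 / 2 ≤ W' := by linarith
    have e : W'⁻¹ - 1 / W = (W - W') / (W' * W) := by
      have : W' ≠ 0 := by linarith
      have : W ≠ 0 := by linarith
      field_simp
    rw [Real.norm_eq_abs, e, abs_div, abs_of_pos (by positivity : 0 < W' * W),
      div_le_div_iff₀ (by positivity) (by positivity)]
    have h3 : |W - W'| ≤ |d| := by rw [abs_le]; constructor <;> linarith
    have h4 : |W - W'| * W ≤ |d| * W := by gcongr
    have h5 : |d| * W * 1 ≤ |d| * W * (2 * W') := by gcongr; linarith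
    linarith
  have h := (convex_closedBall x |d|).norm_image_sub_le_of_norm_hasDerivWithin_le hf hbound
    (Metric.mem_closedBall_self (abs_nonneg d)) (y := x + d) (by simp)
  rw [add_sub_cancel_left, Real.norm_eq_abs, Real.norm_eq_abs] at h
  refine le_of_eq_of_le (congrArg abs ?_) (h.trans_eq ?_)
  · ring
  · rw [← sq_abs d]; ring

theorem abs_arsinh_le (x : ℝ) : |Real.arsinh x| ≤ Real.log (1 + 2 * |x|) := by
  have h : |Real.arsinh x| = Real.arsinh |x| := by
    rcases le_total 0 x with hx | hx
    · rw [abs_of_nonneg hx, abs_of_nonneg (Real.arsinh_nonneg_iff.2 hx)]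
    · rw [abs_of_nonpos hx, abs_of_nonpos (Real.arsinh_nonpos_iff.2 hx), Real.arsinh_neg]
  rw [h, Real.arsinh]
  refine Real.log_le_log (by positivity) ?_
  have : √(1 + |x| ^ 2) ≤ 1 + |x| := by
    rw [Real.sqrt_le_left (by positivity)]
    nlinarith [abs_nonneg x]
  linarith

end Arsinh

theorem driftSq_le_three {s : Fin 3 → ℝ} (hs : s ∈ stdSimplex ℝ (Fin 3)) : driftSq s ≤ 3 := by
  have := sum_sq_le (abs_drift_le_one hs)
  unfold driftSq
  linarith

/-- The drift of `arsinh (h - u₀) / (K δ)` for a function `h` as in `exists_lyapunov_profile`. -/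
theorem arsinh_step_mean {ι : Type} [Fintype ι] {w d : ι → ℝ} {B c K δ n u : ℝ} (hδ : 0 < δ)
    (hδ1 : δ ≤ 1) (hB : 0 < B) (hc : 0 < c) (hn0 : 0 ≤ n) (hn : n ≤ 3)
    (hK1 : 6 * B ≤ K) (hK2 : 8 * B ^ 2 ≤ c * K) (hw0 : ∀ i, 0 ≤ w i) (hw1 : ∑ i, w i = 1)
    (hmean : wmean w d ≤ -(c * (δ * n + δ ^ 2))) (hd : ∀ j, |d j| ≤ B * (δ * √n + δ ^ 2))
    (hu : |u| ≤ B * n) :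
    wmean w (fun j => Real.arsinh ((u + d j) / (K * δ)) - Real.arsinh (u / (K * δ))) ≤
      -(c * δ / (2 * K)) := by
  have hK : 0 < K := by linarith
  have hKδ : 0 < K * δ := by positivity
  have hsn := Real.sqrt_nonneg n
  have hsn2 : √n ≤ 2 := by rw [Real.sqrt_le_left (by norm_num)]; linarith
  have hsq := Real.sq_sqrt hn0
  set x := u / (K * δ) with hx
  set W := √(1 + x ^ 2) with hW
  have hW1 : 1 ≤ W := by rw [hW, Real.one_le_sqrt]; nlinarith [sq_nonneg x]
  have hd2 : ∀ j, d j ^ 2 ≤ 2 * B ^ 2 * δ ^ 2 * (n + δ) := by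
    intro j
    have h1 : d j ^ 2 ≤ (B * (δ * √n + δ ^ 2)) ^ 2 := by
      rw [← sq_abs]; exact pow_le_pow_left₀ (abs_nonneg _) (hd j) 2
    have h2 : (√n + δ) ^ 2 ≤ 2 * (n + δ) := by nlinarith [sq_nonneg (√n - δ)]
    have h3 := mul_le_mul_of_nonneg_left h2 (by positivity : 0 ≤ B ^ 2 * δ ^ 2)
    linarith
  have hstep : ∀ j, Real.arsinh ((u + d j) / (K * δ)) - Real.arsinh x ≤
      (1 / (K * δ * W)) * d j + 4 * B ^ 2 * (n + δ) / (K ^ 2 * W) := by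
    intro j
    have h1 : |d j / (K * δ)| ≤ 1 / 2 := by
      rw [abs_div, abs_of_pos hKδ, div_le_iff₀ hKδ]
      have h2 : δ * √n + δ ^ 2 ≤ 3 * δ := by nlinarith
      have h3 := mul_le_mul_of_nonneg_left h2 hB.le
      have h4 := mul_le_mul_of_nonneg_right hK1 hδ.le
      linarith [hd j]
    have h2 := (abs_le.1 (abs_arsinh_sub_le (x := x) h1)).2
    rw [← hW] at h2
    have e1 : x + d j / (K * δ) = (u + d j) / (K * δ) := by rw [hx]; ring
    rw [e1] at h2
    have e2 : d j / (K * δ) / W = 1 / (K * δ * W) * d j := by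
      field_simp
    have e3 : 2 * (d j / (K * δ)) ^ 2 / W ≤ 4 * B ^ 2 * (n + δ) / (K ^ 2 * W) := by
      have : 2 * (d j / (K * δ)) ^ 2 / W = 2 * d j ^ 2 / (K ^ 2 * δ ^ 2 * W) := by
        field_simp
      rw [this]
      have e4 : 4 * B ^ 2 * (n + δ) / (K ^ 2 * W) =
          2 * (2 * B ^ 2 * δ ^ 2 * (n + δ)) / (K ^ 2 * δ ^ 2 * W) := by
        field_simp; norm_num
      rw [e4]
      gcongr ?_ / _
      linarith [hd2 j]
    linarith
  refine (wmean_mono hw0 hstep).trans ?_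
  rw [wmean_add, wmean_mul, wmean_const hw1]
  have h1 : 1 / (K * δ * W) * wmean w d ≤ 1 / (K * δ * W) * -(c * (δ * n + δ ^ 2)) := by gcongr
  have h2 : 1 / (K * δ * W) * -(c * (δ * n + δ ^ 2)) = -(c * (n + δ) / (K * W)) := by
    field_simp
  -- The choice `8 * B ^ 2 ≤ c * K` limits the second order error to half the linear gain.
  have h3 : 4 * B ^ 2 * (n + δ) / (K ^ 2 * W) ≤ c * (n + δ) / (2 * K * W) := by
    rw [div_le_div_iff₀ (by positivity) (by positivity)]
    have := mul_le_mul_of_nonneg_right hK2 (by positivity : 0 ≤ (n + δ) * K * W)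
    linarith
  have h4 : c * (n + δ) / (K * W) = 2 * (c * (n + δ) / (2 * K * W)) := by
    field_simp
  -- The bound `|u| ≤ B * n` enters here: the damping `1 / W` of `arsinh` is at worst `δ / (n + δ)`,
  -- which exactly offsets the factor `n + δ` in the gain.
  have h5 : δ * W ≤ n + δ := by
    have h6 := sqrt_one_add_sq_le 0 x
    rw [← hW, sub_zero] at h6
    simp only [ne_eq, OfNat.ofNat_ne_zero, not_false_eq_true, zero_pow, add_zero,
      Real.sqrt_one] at h6
    have h7 : δ * |x| ≤ n := by
      rw [hx, abs_div, abs_of_pos hKδ]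
      have h8 : δ * (|u| / (K * δ)) = |u| / K := by field_simp
      rw [h8, div_le_iff₀ hK]
      nlinarith
    nlinarith
  have h6 : c * δ / (2 * K) ≤ c * (n + δ) / (2 * K * W) := by
    rw [div_le_div_iff₀ (by positivity) (by positivity)]
    have := mul_le_mul_of_nonneg_left h5 (by positivity : 0 ≤ 2 * c * K)
    linarith
  linarith

/-- A Lyapunov function with unit drift outside the central region and of size `δ⁻¹ log δ⁻¹`. -/
theorem exists_unit_drift {L : ℝ} (hL : 0 < L) :
    ∃ C δ₀ : ℝ, 0 < C ∧ 0 < δ₀ ∧ ∀ δ, 0 < δ → δ ≤ δ₀ → ∃ V : (Fin 3 → ℝ) → ℝ,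
      (∀ s ∈ stdSimplex ℝ (Fin 3), 0 ≤ V s ∧ V s ≤ C * (1 / δ * Real.log (1 / δ))) ∧
      ∀ (s : Fin 3 → ℝ) (ι : Type) [Fintype ι] (w : ι → ℝ) (v : ι → Fin 3 → ℝ),
        IsStep L δ s w v → rho / 2 ≤ centreDist s →
        wmean w (fun j => V (s + δ • v j)) ≤ V s - 1 := by
  obtain ⟨h, u₀, B, c, δ₀, hB, hc, hδ₀, hbd, hh⟩ := exists_lyapunov_profile hL
  obtain ⟨K, hK1, hK2⟩ : ∃ K, 6 * B ≤ K ∧ 8 * B ^ 2 ≤ c * K := by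
    refine ⟨max (6 * B) (8 * B ^ 2 / c), le_max_left _ _, ?_⟩
    rw [← div_le_iff₀' hc]
    exact le_max_right _ _
  have hK : 0 < K := by linarith
  refine ⟨8 * K / c, min δ₀ (1 / 3), by positivity, by positivity, fun δ hδ hδδ => ?_⟩
  have hδ1 : δ ≤ 1 / 3 := hδδ.trans (min_le_right _ _)
  have hKδ : 0 < K * δ := by positivity
  have hF : ∀ s ∈ stdSimplex ℝ (Fin 3),
      |Real.arsinh ((h s - u₀) / (K * δ))| ≤ 2 * Real.log (1 / δ) := by
    intro s hs
    refine (abs_arsinh_le _).trans ?_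
    have e : 2 * Real.log (1 / δ) = Real.log ((1 / δ) ^ 2) := by rw [Real.log_pow]; norm_num
    rw [e]
    refine Real.log_le_log (by positivity) ?_
    have h1 : |(h s - u₀) / (K * δ)| ≤ 1 / δ := by
      rw [abs_div, abs_of_pos hKδ, div_le_div_iff₀ hKδ hδ]
      have h2 := hbd s hs
      nlinarith
    have h3 : 3 ≤ 1 / δ := by rw [le_div_iff₀ hδ]; linarith
    nlinarith
  -- The prefactor normalises the decrease `c * δ / (2 * K)` to one, and the added `2 * log (1/δ)`
  -- makes the function nonnegative.
  refine ⟨fun s => 2 * K / (c * δ) * (Real.arsinh ((h s - u₀) / (K * δ)) +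
    2 * Real.log (1 / δ)), fun s hs => ?_, fun s ι _ w v hstep hcen => ?_⟩
  · have h1 := abs_le.1 (hF s hs)
    constructor
    · exact mul_nonneg (by positivity) (by linarith)
    · refine (mul_le_mul_of_nonneg_left (b := Real.arsinh ((h s - u₀) / (K * δ)) +
        2 * Real.log (1 / δ)) (c := 4 * Real.log (1 / δ)) (by linarith)
        (by positivity : 0 ≤ 2 * K / (c * δ))).trans_eq ?_
      ring
  · obtain ⟨h1, h2, h3⟩ := hh δ s ι w v hδ (hδδ.trans (min_le_left _ _)) hstep hcen
    have h4 := arsinh_step_mean hδ (by linarith) hB hc (driftSq_nonneg s)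
      (driftSq_le_three hstep.mem) hK1 hK2 hstep.nonneg hstep.sum_one h1 h2 h3
    have e : ∀ j, 2 * K / (c * δ) * (Real.arsinh ((h (s + δ • v j) - u₀) / (K * δ)) +
        2 * Real.log (1 / δ)) = 2 * K / (c * δ) *
        (Real.arsinh ((h s - u₀ + (h (s + δ • v j) - h s)) / (K * δ)) -
        Real.arsinh ((h s - u₀) / (K * δ))) + 2 * K / (c * δ) *
        (Real.arsinh ((h s - u₀) / (K * δ)) + 2 * Real.log (1 / δ)) := by
      intro j
      rw [show h s - u₀ + (h (s + δ • v j) - h s) = h (s + δ • v j) - u₀ by ring]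
      ring
    simp only [e]
    rw [wmean_add, wmean_mul, wmean_const hstep.sum_one]
    have h5 := mul_le_mul_of_nonneg_left h4 (by positivity : 0 ≤ 2 * K / (c * δ))
    have h6 : 2 * K / (c * δ) * -(c * δ / (2 * K)) = -1 := by field_simp
    linarith

/-! ### Glauber increments as one-step laws. -/

section GlauberStep

variable {M : ℕ}

theorem magnetisation_nonneg (σ : Config M) (k : Fin 3) : 0 ≤ magnetisation σ k := by
  unfold magnetisation; positivity

theorem sum_single_eq_magnetisation (σ : Config M) (k : Fin 3) :
    ∑ l, 1 / (M : ℝ) * (Pi.single (σ l) (1 : ℝ) : Fin 3 → ℝ) k = magnetisation σ k := by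
  rw [← Finset.mul_sum]
  simp only [Pi.single_apply, magnetisation, @eq_comm _ k]
  rw [Finset.sum_boole]
  ring

theorem magnetisation_mem (hM : M ≠ 0) (σ : Config M) :
    magnetisation σ ∈ stdSimplex ℝ (Fin 3) := by
  refine ⟨magnetisation_nonneg σ, ?_⟩
  have hM' : (M : ℝ) ≠ 0 := by exact_mod_cast hM
  simp_rw [← sum_single_eq_magnetisation]
  rw [Finset.sum_comm]
  simp_rw [← Finset.mul_sum]
  simp [hM']

theorem one_div_le_magnetisation (σ : Config M) (l : Fin M) :
    1 / (M : ℝ) ≤ magnetisation σ (σ l) := by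
  unfold magnetisation
  gcongr
  exact_mod_cast Finset.card_pos.2 ⟨l, by simp⟩

/-- Each exponential lies between `1` and `exp slope = 16`, and there are three of them. -/
theorem softmax_ge {t : Fin 3 → ℝ} (h0 : ∀ k, 0 ≤ t k) (h1 : ∀ k, t k ≤ 1) (c : Fin 3) :
    1 / 48 ≤ softmax t c := by
  have hs := slope_pos
  have e16 : Real.exp slope = 16 := by
    have : slope = slope * (1 / 2) + slope * (1 / 2) := by ring
    rw [this, Real.exp_add, exp_slope_half]; norm_num
  have hnum : 1 ≤ Real.exp (slope * t c) := Real.one_le_exp (mul_nonneg hs.le (h0 c))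
  have hden : ∑ j, Real.exp (slope * t j) ≤ 48 := by
    have : ∀ j ∈ Finset.univ, Real.exp (slope * t j) ≤ 16 := fun j _ => by
      rw [← e16]; exact Real.exp_le_exp.2 (by nlinarith [h1 j])
    refine (Finset.sum_le_card_nsmul _ _ _ this).trans ?_
    norm_num
  unfold softmax
  exact div_le_div₀ (Real.exp_pos _).le hnum (sum_exp_pos t) hden

theorem softmax_pre_ge (hM : M ≠ 0) (σ : Config M) (l : Fin M) (c : Fin 3) :
    1 / 48 ≤ softmax (magnetisation σ - Pi.single (σ l) (1 / (M : ℝ))) c := by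
  have hδ : (0 : ℝ) ≤ 1 / M := by positivity
  refine softmax_ge (fun k => ?_) (fun k => ?_) c
  · rw [Pi.sub_apply, Pi.single_apply]
    split_ifs with hk
    · rw [hk]; linarith [one_div_le_magnetisation σ l]
    · linarith [magnetisation_nonneg σ k]
  · have h1 : magnetisation σ k ≤ 1 := by
      rw [← (magnetisation_mem hM σ).2]
      exact Finset.single_le_sum (fun j _ => magnetisation_nonneg σ j) (Finset.mem_univ k)
    rw [Pi.sub_apply, Pi.single_apply]
    split_ifs <;> linarith

/-- The probability of choosing spin `l` and giving it colour `c`. -/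
def stepWeight (σ : Config M) (p : Fin M × Fin 3) : ℝ :=
  1 / (M : ℝ) * softmax (magnetisation σ - Pi.single (σ p.1) (1 / (M : ℝ))) p.2

/-- The rescaled increment of the magnetisation when spin `l` gets colour `c`. -/
def stepIncr (σ : Config M) (p : Fin M × Fin 3) : Fin 3 → ℝ :=
  Pi.single p.2 1 - Pi.single (σ p.1) 1

theorem magnetisation_add_stepIncr (σ : Config M) (p : Fin M × Fin 3) :
    magnetisation σ + (1 / (M : ℝ)) • stepIncr σ p =
      magnetisation (Function.update σ p.1 p.2) := by
  rw [magnetisation_update, stepIncr, smul_sub, ← Pi.single_smul, ← Pi.single_smul, smul_eq_mul,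
    mul_one]
  abel

theorem sum_glauber_eq_wmean (hM : M ≠ 0) (σ : Config M) (h : Config M → ℝ) :
    ∑ σ', glauber M betaCrit σ σ' * h σ' =
      wmean (stepWeight σ) fun p => h (Function.update σ p.1 p.2) := by
  rw [sum_glauber_mul, wmean, Fintype.sum_prod_type]
  refine Finset.sum_congr rfl fun l _ => ?_
  rw [Finset.mul_sum]
  refine Finset.sum_congr rfl fun c _ => ?_
  rw [spinCondProb_eq hM, stepWeight, mul_assoc]

theorem stepWeight_ge (hM : M ≠ 0) (σ : Config M) (p : Fin M × Fin 3) :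
    1 / (M : ℝ) * (1 / 48) ≤ stepWeight σ p :=
  mul_le_mul_of_nonneg_left (softmax_pre_ge hM σ p.1 p.2) (by positivity)

theorem stepWeight_nonneg (σ : Config M) (p : Fin M × Fin 3) : 0 ≤ stepWeight σ p :=
  mul_nonneg (by positivity) (softmax_pos _ _).le

theorem sum_stepWeight (hM : M ≠ 0) (σ : Config M) : ∑ p, stepWeight σ p = 1 := by
  have hM' : (M : ℝ) ≠ 0 := by exact_mod_cast hM
  rw [Fintype.sum_prod_type]
  simp only [stepWeight, ← Finset.mul_sum, sum_softmax]
  simp [hM']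

/-- Removing the chosen spin shifts the argument of softmax by at most `1 / M`, whence the error `L
/ M` of the mean. For the variance, whichever spin is chosen, some new colour changes coordinate `k`
by a full unit, and it has conditional probability at least `1/48`. -/
theorem exists_isStep : ∃ L : ℝ, 0 < L ∧ ∀ (M : ℕ), M ≠ 0 → ∀ σ : Config M,
    IsStep L (1 / (M : ℝ)) (magnetisation σ) (stepWeight σ) (stepIncr σ) := by
  obtain ⟨L, hL, hlip⟩ := exists_softmax_lipschitz
  refine ⟨L, hL, fun M hM σ => ?_⟩
  have hM' : (M : ℝ) ≠ 0 := by exact_mod_cast hM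
  have hM1 : (1 : ℝ) ≤ M := by exact_mod_cast Nat.one_le_iff_ne_zero.2 hM
  have hδ : (0 : ℝ) ≤ 1 / M := by positivity
  have hδ1 : (1 : ℝ) / M ≤ 1 := by rw [div_le_one (by linarith)]; exact hM1
  have hsum1 : ∑ _l : Fin M, 1 / (M : ℝ) = 1 := by simp [hM']
  refine ⟨magnetisation_mem hM σ, fun p => ?_, stepWeight_nonneg σ, sum_stepWeight hM σ,
    fun p k => ?_, fun k => ?_, fun k => ?_⟩
  · rw [magnetisation_add_stepIncr]; exact magnetisation_mem hM _
  · simp only [stepIncr, Pi.sub_apply, Pi.single_apply]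
    split_ifs <;> norm_num
  · have e : wmean (stepWeight σ) (fun p => stepIncr σ p k) - drift (magnetisation σ) k =
        ∑ l, 1 / (M : ℝ) * (softmax (magnetisation σ - Pi.single (σ l) (1 / (M : ℝ))) k -
          softmax (magnetisation σ) k) := by
      have e1 : wmean (stepWeight σ) (fun p => stepIncr σ p k) =
          ∑ l, (1 / (M : ℝ) * softmax (magnetisation σ - Pi.single (σ l) (1 / (M : ℝ))) k -
            1 / (M : ℝ) * (Pi.single (σ l) (1 : ℝ) : Fin 3 → ℝ) k) := by
        rw [wmean, Fintype.sum_prod_type]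
        refine Finset.sum_congr rfl fun l _ => ?_
        simp only [stepWeight, stepIncr, Pi.sub_apply, mul_sub, Finset.sum_sub_distrib]
        congr 1
        · simp [Pi.single_apply]
        · rw [← Finset.sum_mul, ← Finset.mul_sum, sum_softmax, mul_one]
      rw [e1, Finset.sum_sub_distrib, sum_single_eq_magnetisation, drift]
      simp only [mul_sub, Finset.sum_sub_distrib]
      rw [← Finset.sum_mul, hsum1]
      ring
    rw [e]
    refine (Finset.abs_sum_le_sum_abs _ _).trans ?_
    have hterm : ∀ l ∈ Finset.univ, |1 / (M : ℝ) *
        (softmax (magnetisation σ - Pi.single (σ l) (1 / (M : ℝ))) k -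
          softmax (magnetisation σ) k)| ≤ 1 / (M : ℝ) * (L * (1 / (M : ℝ))) := by
      intro l _
      rw [abs_mul, abs_of_nonneg hδ]
      refine mul_le_mul_of_nonneg_left ?_ hδ
      have hn : ‖(Pi.single (σ l) (1 / (M : ℝ)) : Fin 3 → ℝ)‖ ≤ 1 / M := by
        rw [pi_norm_le_iff_of_nonneg hδ]
        intro k
        rw [Pi.single_apply]
        split_ifs
        · rw [Real.norm_eq_abs, abs_of_nonneg hδ]
        · simp
      have hs := norm_le_one_of_mem (magnetisation_mem hM σ)
      refine (hlip _ _ ?_ (by linarith) k).trans ?_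
      · refine (norm_sub_le _ _).trans ?_
        linarith
      · rw [sub_sub_cancel_left, norm_neg]
        exact mul_le_mul_of_nonneg_left hn hL.le
    refine (Finset.sum_le_sum hterm).trans_eq ?_
    rw [← Finset.sum_mul, hsum1, one_mul]
  · rw [wmean, Fintype.sum_prod_type]
    have hterm : ∀ l ∈ Finset.univ, 1 / (M : ℝ) * (1 / 48) ≤
        ∑ c, stepWeight σ (l, c) * stepIncr σ (l, c) k ^ 2 := by
      intro l _
      obtain ⟨c, hc⟩ : ∃ c, stepIncr σ (l, c) k ^ 2 = 1 := by
        by_cases hk : σ l = k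
        · refine ⟨k + 1, ?_⟩
          have : k ≠ k + 1 := by fin_cases k <;> decide
          simp [stepIncr, hk, this]
        · refine ⟨k, ?_⟩
          simp [stepIncr, Ne.symm hk]
      have h1 : stepWeight σ (l, c) * stepIncr σ (l, c) k ^ 2 ≤
          ∑ c, stepWeight σ (l, c) * stepIncr σ (l, c) k ^ 2 :=
        Finset.single_le_sum (f := fun c => stepWeight σ (l, c) * stepIncr σ (l, c) k ^ 2)
          (fun c _ => mul_nonneg (stepWeight_nonneg σ _) (sq_nonneg _)) (Finset.mem_univ c)
      rw [hc, mul_one] at h1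
      exact (stepWeight_ge hM σ (l, c)).trans h1
    refine le_trans ?_ (Finset.sum_le_sum hterm)
    rw [← Finset.sum_mul, hsum1, one_mul]

end GlauberStep

/-! ### Lyapunov functions for large and for small `M`. -/

theorem exists_hasLyapunov_large : ∃ (C : ℝ) (M₀ : ℕ), 0 < C ∧
    ∀ M : ℕ, M₀ ≤ M → HasLyapunov M C := by
  obtain ⟨L, hL, hstep⟩ := exists_isStep
  obtain ⟨C, δ₀, hC, hδ₀, hV⟩ := exists_unit_drift hL
  obtain ⟨N, hN⟩ := exists_nat_gt (1 / δ₀)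
  refine ⟨C, N + 1, hC, fun M hM => ?_⟩
  have hM0 : M ≠ 0 := by omega
  have hMpos : (0 : ℝ) < M := by exact_mod_cast Nat.pos_of_ne_zero hM0
  have hδ : 1 / (M : ℝ) ≤ δ₀ := by
    have h1 : (N : ℝ) ≤ M := by exact_mod_cast (by omega : N ≤ M)
    rw [div_lt_iff₀ hδ₀] at hN
    rw [div_le_iff₀ hMpos]
    nlinarith
  obtain ⟨V, hV0, hV1⟩ := hV (1 / M) (by positivity) hδ
  rw [one_div_one_div] at hV0
  refine ⟨fun σ => V (magnetisation σ), fun σ => (hV0 _ (magnetisation_mem hM0 σ)).1,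
    fun σ => (hV0 _ (magnetisation_mem hM0 σ)).2, fun σ hσ => ?_⟩
  rw [sum_glauber_eq_wmean hM0]
  have h := hV1 _ _ _ _ (hstep M hM0 σ) (not_le.1 hσ).le
  simpa only [magnetisation_add_stepIncr] using h

/-- From any non-central state some single update reduces the Hamming distance to a fixed central
`τ`, with probability at least `2 q`. A geometric sum of the distance, with ratio `q`, makes this
outweigh all unfavourable updates; the constant may depend on `M`. -/
theorem exists_hasLyapunov_fixed {M : ℕ} (hM : 3 ≤ M) (hne : (central M).Nonempty) :
    ∃ C : ℝ, HasLyapunov M C := by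
  obtain ⟨τ, hτ⟩ := hne
  have hM0 : M ≠ 0 := by omega
  have hM3 : (3 : ℝ) ≤ M := by exact_mod_cast hM
  have hMpos : (0 : ℝ) < M := by linarith
  set q : ℝ := 1 / (M : ℝ) * (1 / 48) / 2 with hq
  have hq0 : 0 < q := by positivity
  have hq1 : q ≤ 1 := by
    have : 1 / (M : ℝ) ≤ 1 := by rw [div_le_one hMpos]; linarith
    rw [hq]; linarith
  let U : ℕ → ℝ := fun d => ∑ i ∈ Finset.range d, q ^ i
  have hU : Monotone U := fun a b hab =>
    Finset.sum_le_sum_of_subset_of_nonneg (Finset.range_mono hab) fun _ _ _ => by positivity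
  have hUs : ∀ d, U (d + 1) = U d + q ^ d := fun d => Finset.sum_range_succ _ _
  have hdM : ∀ σ : Config M, hammingDist σ τ ≤ M := fun σ => by
    simpa using hammingDist_le_card_fintype (x := σ) (y := τ)
  have hML : 1 ≤ M * Real.log M := by nlinarith [one_le_log_of_three_le hM]
  have hqM : 0 < q ^ M := by positivity
  refine ⟨U M / q ^ M, fun σ => U (hammingDist σ τ) / q ^ M, fun σ => ?_, fun σ => ?_,
    fun σ hσ => ?_⟩
  · exact div_nonneg (Finset.sum_nonneg fun _ _ => by positivity) hqM.le
  · have h1 : U (hammingDist σ τ) / q ^ M ≤ U M / q ^ M := by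
      gcongr; exact hU (hdM σ)
    have h2 : 0 ≤ U M / q ^ M :=
      div_nonneg (Finset.sum_nonneg fun _ _ => by positivity) hqM.le
    nlinarith
  rw [sum_glauber_eq_wmean hM0]
  set d := hammingDist σ τ with hd
  have hne : σ ≠ τ := fun h => hσ (h ▸ hτ)
  obtain ⟨l, hl⟩ := Function.ne_iff.1 hne
  have hup : ∀ p : Fin M × Fin 3, hammingDist (Function.update σ p.1 p.2) τ ≤ d + 1 := by
    intro p
    have h1 : hammingDist (Function.update σ p.1 p.2) σ ≤ 1 := by
      refine (Finset.card_le_card (t := {p.1}) fun i hi => ?_).trans (by simp)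
      by_contra hne
      simp only [Finset.mem_singleton] at hne
      simp [Function.update_of_ne hne] at hi
    have h2 := hammingDist_triangle (Function.update σ p.1 p.2) σ τ
    omega
  have hdown : hammingDist (Function.update σ l (τ l)) τ + 1 ≤ d := by
    refine Nat.succ_le_of_lt (Finset.card_lt_card ?_)
    rw [Finset.ssubset_iff_of_subset]
    · exact ⟨l, by simpa using hl, by simp⟩
    · intro i hi
      simp only [Finset.mem_filter, Finset.mem_univ, true_and] at hi ⊢
      by_cases hil : i = l
      · subst hil; exact hl
      · rwa [Function.update_of_ne hil] at hi
  obtain ⟨e, he⟩ : ∃ e, d = e + 1 := ⟨d - 1, by omega⟩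
  have hw := stepWeight_ge hM0 σ (l, τ l)
  have hmean : wmean (stepWeight σ) (fun p => U (hammingDist (Function.update σ p.1 p.2) τ)) ≤
      U d - q ^ M := by
    have h1 : wmean (stepWeight σ) (fun p => U (hammingDist (Function.update σ p.1 p.2) τ)) ≤
        U (d + 1) - stepWeight σ (l, τ l) * (U (d + 1) - U e) := by
      have h2 : ∑ p, stepWeight σ p * (U (d + 1) - U (hammingDist (Function.update σ p.1 p.2) τ)) ≥
          stepWeight σ (l, τ l) *
            (U (d + 1) - U (hammingDist (Function.update σ l (τ l)) τ)) :=
        Finset.single_le_sum (f := fun p => stepWeight σ p *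
          (U (d + 1) - U (hammingDist (Function.update σ p.1 p.2) τ)))
          (fun p _ => mul_nonneg (stepWeight_nonneg σ p) (sub_nonneg.2 (hU (hup p))))
          (Finset.mem_univ (l, τ l))
      have h3 : U (hammingDist (Function.update σ l (τ l)) τ) ≤ U e := hU (by omega)
      have h4 := mul_le_mul_of_nonneg_left h3 (stepWeight_nonneg σ (l, τ l))
      simp only [mul_sub, Finset.sum_sub_distrib] at h2
      rw [← Finset.sum_mul, sum_stepWeight hM0] at h2
      unfold wmean
      linarith
    have h5 : U (d + 1) - U e = q ^ d + q ^ e := by rw [hUs, he, hUs]; ring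
    have h6 : q ^ d = q * q ^ e := by rw [he, pow_succ]; ring
    have h7 : q ^ M ≤ q ^ d := pow_le_pow_of_le_one hq0.le hq1 (hdM σ)
    -- Going up costs at most `q ^ d`, while the good move gains at least `2 * q * q ^ e = 2 * q ^
    -- d`, a net decrease of `q ^ d ≥ q ^ M`.
    have h8 : 2 * q * q ^ e ≤ stepWeight σ (l, τ l) * (q ^ d + q ^ e) := by
      have h9 : 2 * q ≤ stepWeight σ (l, τ l) := by rw [hq]; linarith
      have h10 : 0 < q ^ e := by positivity
      have h11 : 0 < q ^ d := by positivity
      exact mul_le_mul h9 (by linarith) h10.le (by linarith)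
    rw [h5, hUs d] at h1
    linarith
  have e1 : ∀ x, x / q ^ M = (q ^ M)⁻¹ * x := fun x => by rw [div_eq_inv_mul]
  simp only [e1]
  rw [wmean_mul]
  have h12 := mul_le_mul_of_nonneg_left hmean (inv_pos.2 hqM).le
  rw [mul_sub, inv_mul_cancel₀ hqM.ne'] at h12
  exact h12

/-- All coordinates of the centres are at least `1/6`, so a central configuration uses all three
colours. This excludes the small `M` for which `M log M` could be below one. -/
theorem three_le_of_central {M : ℕ} {z : Fin 3 → ℝ} (hz : z ∈ magStates M)
    (hc : centreDist z ≤ rho / 2) : 3 ≤ M := by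
  obtain ⟨σ, rfl⟩ := hz
  obtain ⟨j, hj⟩ : ∃ j, triDist (magnetisation σ) (centre j) ≤ rho / 2 := by
    simp only [centreDist, min_le_iff] at hc
    rcases hc with (h | h) | (h | h)
    exacts [⟨_, h⟩, ⟨_, h⟩, ⟨_, h⟩, ⟨_, h⟩]
  have hpos : ∀ k, 0 < magnetisation σ k := by
    intro k
    have h1 : √(∑ k, (magnetisation σ k - centre j k) ^ 2) ≤ √2 * (rho / 2) := by
      unfold triDist at hj
      rwa [one_div, inv_mul_le_iff₀ (by positivity)] at hj
    have h2 : |magnetisation σ k - centre j k| ≤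
        √(∑ k, (magnetisation σ k - centre j k) ^ 2) :=
      Real.abs_le_sqrt (Finset.single_le_sum
        (f := fun k => (magnetisation σ k - centre j k) ^ 2) (fun _ _ => sq_nonneg _)
        (Finset.mem_univ k))
    have h3 : √2 ≤ 2 := by rw [Real.sqrt_le_left (by norm_num)]; norm_num
    have h4 : 1 / 6 ≤ centre j k := by
      fin_cases j <;> fin_cases k <;> simp [centre] <;> norm_num
    have h5 := (abs_le.1 (h2.trans h1)).1
    unfold rho at h5
    nlinarith
  have hsurj : Function.Surjective σ := by
    intro k
    by_contra! hk
    have : magnetisation σ k = 0 := by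
      simp [magnetisation, hk]
    exact (hpos k).ne' this
  simpa using Fintype.card_le_of_surjective σ hsurj

/-- Only finitely many `M` lie below the threshold, so adding their individual constants gives an
absolute one. -/
theorem exists_hasLyapunov : ∃ C : ℝ, 0 < C ∧ ∀ M : ℕ, 3 ≤ M → (central M).Nonempty →
    HasLyapunov M C := by
  obtain ⟨C, M₀, hC, hlarge⟩ := exists_hasLyapunov_large
  have hex : ∀ M : ℕ, ∃ C' : ℝ, 3 ≤ M → (central M).Nonempty → HasLyapunov M C' := by
    intro M
    by_cases h : 3 ≤ M ∧ (central M).Nonempty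
    · obtain ⟨C', hC'⟩ := exists_hasLyapunov_fixed h.1 h.2
      exact ⟨C', fun _ _ => hC'⟩
    · exact ⟨0, fun h1 h2 => (h ⟨h1, h2⟩).elim⟩
  choose C' hC' using hex
  have hsum : 0 ≤ ∑ i ∈ Finset.range M₀, |C' i| := Finset.sum_nonneg fun _ _ => abs_nonneg _
  refine ⟨C + ∑ i ∈ Finset.range M₀, |C' i|, by positivity, fun M hM hne => ?_⟩
  by_cases hMM : M₀ ≤ M
  · exact (hlarge M hMM).mono hM (by linarith)
  · refine (hC' M hM hne).mono hM ?_
    have h1 : |C' M| ≤ ∑ i ∈ Finset.range M₀, |C' i| :=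
      Finset.single_le_sum (f := fun i => |C' i|) (fun _ _ => abs_nonneg _)
        (Finset.mem_range.2 (not_le.1 hMM))
    linarith [le_abs_self (C' M)]

end MeanFieldPotts

end

theorem mainTheorem7 :
    ∃ C : ℝ, 0 < C ∧
      ∀ (M : ℕ),
        (∃ z ∈ MeanFieldPotts.magStates M,
          MeanFieldPotts.centreDist z ≤ MeanFieldPotts.rho / 2) →
        ∀ {Ω : Type*} [MeasurableSpace Ω] (μ : Measure Ω) [IsProbabilityMeasure μ]
          (σ : ℕ → Ω → MeanFieldPotts.Config M),
          MeanFieldPotts.IsMarkovChain μ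
            (MeanFieldPotts.glauber M MeanFieldPotts.betaCrit) σ →
          ∀ S : ℕ → Ω → Fin 3 → ℝ,
            (∀ k ω, S k ω = MeanFieldPotts.magnetisation (σ k ω)) →
            ∀ s ∈ MeanFieldPotts.magStates M,
              μ {ω | S 0 ω = s} ≠ 0 →
              ∀ r : ℝ, 0 ≤ r →
                (μ[|{ω | S 0 ω = s}]).real
                    {ω | ((r * (C * M * Real.log M) : ℝ) : EReal) <
                      ((MeanFieldPotts.hitTime fun k => S k ω : ℕ∞) : EReal)} ≤
                  Real.exp (-(⌊r⌋ : ℝ)) := by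
  obtain ⟨C, hC, h⟩ := MeanFieldPotts.exists_hasLyapunov
  refine ⟨Real.exp 1 * C + 1, by positivity, ?_⟩
  rintro M ⟨z, hz, hzc⟩ Ω _ μ _ σ hσ S hS s - hs r hr
  have hM := MeanFieldPotts.three_le_of_central hz hzc
  have hne : (MeanFieldPotts.central M).Nonempty := by
    obtain ⟨τ, rfl⟩ := hz
    exact ⟨τ, hzc⟩
  exact MeanFieldPotts.tail_bound hM hC.le (h M hM hne) μ σ hσ S hS s hs r hr
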